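/- For $n\in\mathbb Z$ let $\pi_n=\langle a,b\mid aw^n=w^nb\rangle$, $w=[a,b^{-1}]=ab^{-1}a^{-1}b$, be the knot group of the twist knot $J(2,2n)$. Let $\mathcal S_n\in\mathbb Z[z]$ ($n\in\mathbb Z$) be the Chebyshev polynomials given by $\mathcal S_0=0$, $\mathcal S_1=1$, $\mathcal S_{n+1}(z)-z\,\mathcal S_n(z)+\mathcal S_{n-1}(z)=0$. In $\mathbb Z[x,y]$ put $z=2x^2-x^2y+y^2-2$, $$f_n(x,y)=(y-1)\mathcal S_n(z)-\mathcal S_{n-1}(z),\qquad \tau_n(x,y)=(2-x)\,\frac{\mathcal S_{n+1}(z)-\mathcal S_{n-1}(z)-2}{z-2}+x\,\mathcal S_n(z)$$ (the division by $z-2$ is exact). Define $k_n,g_n,h_n\in\mathbb Z[x]$ for all $n\in\mathbb Z$ by $k_0=-1$, $k_1=1$, $g_0=-1$, $g_1=x-1$, $h_0=0$, $h_1=1$, $$k_{2n}-(x^2-3x)k_{2n-1}+k_{2n-2}=0,\qquad k_{2n+1}+xk_{2n}+k_{2n-1}=0,$$ $$g_{2n}+xg_{2n-1}+g_{2n-2}=0,\qquad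 g_{2n+1}-(x^2-3x)g_{2n}+g_{2n-1}=0,$$ and the same recurrence for $h_n$ as for $g_n$. Then for every $n\in\mathbb Z$: (1) $f_n(x,x)=g_nk_n$ and $\tau_n(x,x)=2h_nk_n$. (2) $k_{2n}=\mathcal S_{3n}(1-x)+\mathcal S_{3n-1}(1-x)$ and $k_{2n+1}=\mathcal S_{3n+1}(1-x)$. (3) $k_n$ is a greatest common divisor of $f_n(x,x)$ and $\tau_n(x,x)$ in $\mathbb Z[x]$. (4) Let $F$ be a finite field of characteristic $p>2$. A representation $\rho:\pi_n\to\mathrm{SL}_2(F)$ is called absolutely irreducible if it is irreducible over an algebraic closure of $F$, and non-acyclic if $H_i(\pi_n,\rho)\neq0$ for some $i\ge 0$. Every absolutely irreducible non-acyclic $\rho:\pi_n\to\mathrm{SL}_2(F)$ corresponds to a root of $k_n$ in $F$, namely $\mathrm{tr}\,\rho(a)=\mathrm{tr}\,\rho(ab)=\alpha$ for some $\alpha\in F$ with $k_n(\alpha)=0$, and moreover $\alpha\ne-1$. Conversely, every root $\alpha\neq-1$ of $k_n$ in $F$ arises in this way from an absolutely irreducible non-acyclic $\rho:\pi_n\to\mathrm{SL}_2(F)$,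 and any two absolutely irreducible representations $\pi_n\to\mathrm{SL}_2(F)$ with $\mathrm{tr}\,\rho(a)=\mathrm{tr}\,\rho(ab)=\alpha$ are conjugate by an element of $\mathrm{GL}_2(F)$. -/

import Mathlib

open Polynomial

noncomputable section

namespace TwistKnot

/-! ### Chebyshev polynomials and the polynomials `f n`, `τ n` -/

/-- The Chebyshev polynomial `𝒮 n` of the second kind, `𝒮 n (2 cos θ) = sin (n θ) / sin θ`,
for `n : ℤ`. It is Mathlib's `S` with the index shifted by one. -/
def cheb (n : ℤ) : ℤ[X] := Polynomial.Chebyshev.S ℤ (n - 1)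

theorem cheb_zero : cheb 0 = 0 := by simp [cheb]

theorem cheb_one : cheb 1 = 1 := by simp [cheb]

theorem cheb_neg_one : cheb (-1) = -1 := by
  have : (-1 - 1 : ℤ) = -2 := by norm_num
  rw [cheb, this, Polynomial.Chebyshev.S_neg_two]

theorem cheb_rec (n : ℤ) : cheb (n + 1) - X * cheb n + cheb (n - 1) = 0 := by
  have h := Polynomial.Chebyshev.S_add_one ℤ (n - 1)
  have h1 : n + 1 - 1 = n - 1 + 1 := by ring
  rw [cheb, cheb, cheb, h1, h]
  ring

theorem cheb_eval_two (n : ℤ) : (cheb n).eval 2 = n := by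
  simp [cheb, Polynomial.Chebyshev.S_eval_two]

/-- The variable `x` (the trace of `a`) of `ℤ[x, y]`. -/
def x : MvPolynomial (Fin 2) ℤ := MvPolynomial.X 0

/-- The variable `y` (the trace of `ab`) of `ℤ[x, y]`. -/
def y : MvPolynomial (Fin 2) ℤ := MvPolynomial.X 1

/-- `z = 2x² - x²y + y² - 2` (the trace of `w`). -/
def z : MvPolynomial (Fin 2) ℤ := 2 * x ^ 2 - x ^ 2 * y + y ^ 2 - 2

/-- `f n = (y - 1) 𝒮 n (z) - 𝒮 (n-1) (z)` in `ℤ[x, y]`. -/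
def f (n : ℤ) : MvPolynomial (Fin 2) ℤ :=
  (y - 1) * aeval z (cheb n) - aeval z (cheb (n - 1))

/-- The quotient `(𝒮 (n+1) - 𝒮 (n-1) - 2) / (X - 2)` in `ℤ[X]`;
the division is exact by `torsionQuot_mul`. -/
def torsionQuot (n : ℤ) : ℤ[X] := (cheb (n + 1) - cheb (n - 1) - 2) /ₘ (X - C 2)

theorem torsionQuot_mul (n : ℤ) :
    (X - 2) * torsionQuot n = cheb (n + 1) - cheb (n - 1) - 2 := by
  have h : (cheb (n + 1) - cheb (n - 1) - 2).IsRoot 2 := by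
    simp only [IsRoot, eval_sub, cheb_eval_two, eval_ofNat]
    ring
  exact Polynomial.mul_divByMonic_eq_iff_isRoot.mpr h

/-- The torsion polynomial
`τ n = (2 - x) (𝒮 (n+1) (z) - 𝒮 (n-1) (z) - 2) / (z - 2) + x 𝒮 n (z)` in `ℤ[x, y]`. -/
def τ (n : ℤ) : MvPolynomial (Fin 2) ℤ :=
  (2 - x) * aeval z (torsionQuot n) + x * aeval z (cheb n)

theorem sub_two_mul_τ (n : ℤ) :
    (z - 2) * τ n = (2 - x) * (aeval z (cheb (n + 1)) - aeval z (cheb (n - 1)) - 2)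
      + x * (z - 2) * aeval z (cheb n) := by
  have h := congrArg (aeval z) (torsionQuot_mul n)
  simp only [map_mul, map_sub, aeval_X, map_ofNat] at h
  rw [τ, ← h]
  ring

/-- Restriction `P(x, y) ↦ P(x, x)` to the diagonal. -/
def diag : MvPolynomial (Fin 2) ℤ →ₐ[ℤ] ℤ[X] := MvPolynomial.aeval ![X, X]

/-! ### The polynomials `k n`, `g n`, `h n` -/

/-- The two-sided sequence with `u 0 = u₀`, `u 1 = u₁` and
`u (n + 1) = c n * u n - u (n - 1)` for all `n : ℤ` (see `recSeq_rec`). -/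
def recSeq (c : ℤ → ℤ[X]) (u₀ u₁ : ℤ[X]) : ℤ → ℤ[X]
  | 0 => u₀
  | 1 => u₁
  | (n : ℕ) + 2 => c (n + 1) * recSeq c u₀ u₁ (n + 1) - recSeq c u₀ u₁ n
  | -((n : ℕ) + 1) => c (-n) * recSeq c u₀ u₁ (-n) - recSeq c u₀ u₁ (-n + 1)
  termination_by n => Int.natAbs n + Int.natAbs (n - 1)

theorem recSeq_zero (c : ℤ → ℤ[X]) (u₀ u₁ : ℤ[X]) : recSeq c u₀ u₁ 0 = u₀ := by
  rw [recSeq]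

theorem recSeq_one (c : ℤ → ℤ[X]) (u₀ u₁ : ℤ[X]) : recSeq c u₀ u₁ 1 = u₁ := by
  rw [recSeq]

theorem recSeq_rec (c : ℤ → ℤ[X]) (u₀ u₁ : ℤ[X]) (n : ℤ) :
    recSeq c u₀ u₁ (n + 1) - c n * recSeq c u₀ u₁ n + recSeq c u₀ u₁ (n - 1) = 0 := by
  obtain ⟨m, rfl | rfl⟩ := n.eq_nat_or_neg
  · cases m with
    | zero =>
      have h : recSeq c u₀ u₁ (-((0 : ℕ) + 1)) = _ := recSeq.eq_4 c u₀ u₁ 0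
      simp only [Nat.cast_zero, neg_zero, zero_add, zero_sub] at h ⊢
      rw [h]
      ring
    | succ m =>
      have h : recSeq c u₀ u₁ ((m : ℕ) + 2) = _ := recSeq.eq_3 c u₀ u₁ m
      have h1 : ((m + 1 : ℕ) : ℤ) + 1 = (m : ℤ) + 2 := by push_cast; ring
      have h2 : ((m + 1 : ℕ) : ℤ) - 1 = (m : ℤ) := by push_cast; ring
      rw [h1, h2, h]
      push_cast
      ring
  · have h : recSeq c u₀ u₁ (-((m : ℕ) + 1)) = _ := recSeq.eq_4 c u₀ u₁ m
    have h1 : -(m : ℤ) - 1 = -((m : ℤ) + 1) := by ring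
    rw [h1, h]
    ring

/-- `k 0 = -1`, `k 1 = 1`, `k (2m) - (x² - 3x) k (2m-1) + k (2m-2) = 0` and
`k (2m+1) + x k (2m) + k (2m-1) = 0`. -/
def k : ℤ → ℤ[X] := recSeq (fun m => if Even m then -X else X ^ 2 - 3 * X) (-1) 1

/-- `g 0 = -1`, `g 1 = x - 1`, `g (2m) + x g (2m-1) + g (2m-2) = 0` and
`g (2m+1) - (x² - 3x) g (2m) + g (2m-1) = 0`. -/
def g : ℤ → ℤ[X] := recSeq (fun m => if Even m then X ^ 2 - 3 * X else -X) (-1) (X - 1)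

/-- `h 0 = 0`, `h 1 = 1`, with the same recurrence as `g`. -/
def h : ℤ → ℤ[X] := recSeq (fun m => if Even m then X ^ 2 - 3 * X else -X) 0 1

theorem k_rec_even (m : ℤ) :
    k (2 * m) - (X ^ 2 - 3 * X) * k (2 * m - 1) + k (2 * m - 2) = 0 := by
  have H := recSeq_rec (fun m => if Even m then -X else X ^ 2 - 3 * X) (-1) 1 (2 * m - 1)
  have h1 : ¬ Even (2 * m - 1) := by rw [Int.not_even_iff_odd]; exact ⟨m - 1, by ring⟩
  have h2 : 2 * m - 1 + 1 = 2 * m := by ring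
  have h3 : 2 * m - 1 - 1 = 2 * m - 2 := by ring
  simpa only [k, h1, if_false, h2, h3] using H

theorem k_rec_odd (m : ℤ) : k (2 * m + 1) + X * k (2 * m) + k (2 * m - 1) = 0 := by
  have H := recSeq_rec (fun m => if Even m then -X else X ^ 2 - 3 * X) (-1) 1 (2 * m)
  have h1 : Even (2 * m) := even_two_mul m
  simpa only [k, h1, if_true, neg_mul, sub_neg_eq_add] using H

theorem g_rec_even (m : ℤ) : g (2 * m) + X * g (2 * m - 1) + g (2 * m - 2) = 0 := by
  have H := recSeq_rec (fun m => if Even m then X ^ 2 - 3 * X else -X) (-1) (X - 1) (2 * m - 1)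
  have h1 : ¬ Even (2 * m - 1) := by rw [Int.not_even_iff_odd]; exact ⟨m - 1, by ring⟩
  have h2 : 2 * m - 1 + 1 = 2 * m := by ring
  have h3 : 2 * m - 1 - 1 = 2 * m - 2 := by ring
  simpa only [g, h1, if_false, h2, h3, neg_mul, sub_neg_eq_add] using H

theorem g_rec_odd (m : ℤ) :
    g (2 * m + 1) - (X ^ 2 - 3 * X) * g (2 * m) + g (2 * m - 1) = 0 := by
  have H := recSeq_rec (fun m => if Even m then X ^ 2 - 3 * X else -X) (-1) (X - 1) (2 * m)
  have h1 : Even (2 * m) := even_two_mul m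
  simpa only [g, h1, if_true] using H

/-! ### The group `π n` and its representations -/

/-- The word `w = [a, b⁻¹] = a b⁻¹ a⁻¹ b` in the free group on `a = of 0`, `b = of 1`. -/
def word : FreeGroup (Fin 2) :=
  FreeGroup.of 0 * (FreeGroup.of 1)⁻¹ * (FreeGroup.of 0)⁻¹ * FreeGroup.of 1

/-- The knot group `⟨a, b ∣ a wⁿ = wⁿ b⟩` of the twist knot `J(2, 2n)`. -/
abbrev KnotGroup (n : ℤ) : Type :=
  PresentedGroup
    ({(FreeGroup.of 0 * word ^ n) * (word ^ n * FreeGroup.of 1)⁻¹} : Set (FreeGroup (Fin 2)))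

/-- The generator `a` of `π n`. -/
def genA (n : ℤ) : KnotGroup n := PresentedGroup.of 0

/-- The generator `b` of `π n`. -/
def genB (n : ℤ) : KnotGroup n := PresentedGroup.of 1

open Matrix

/-- The linear representation of `G` on `F²` (column vectors) given by `ρ : G → SL₂(F)`. -/
def linRep {G F : Type*} [Group G] [Field F] (ρ : G →* SpecialLinearGroup (Fin 2) F) :
    Representation F G (Fin 2 → F) where
  toFun γ := Matrix.toLin' (ρ γ : Matrix (Fin 2) (Fin 2) F)
  map_one' := by simp [Module.End.one_eq_id]
  map_mul' γ δ := by simp [Matrix.toLin'_mul, Module.End.mul_eq_comp]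

/-- `ρ` is absolutely irreducible: it is irreducible over an algebraic closure of `F`. -/
def IsAbsIrreducible {G F : Type*} [Group G] [Field F]
    (ρ : G →* SpecialLinearGroup (Fin 2) F) : Prop :=
  (linRep ((SpecialLinearGroup.map (algebraMap F (AlgebraicClosure F))).comp ρ)).IsIrreducible

/-- `ρ` is acyclic: the group homology `H_i(G, ρ)` vanishes for every `i`. -/
def IsAcyclic {G F : Type} [Group G] [Field F]
    (ρ : G →* SpecialLinearGroup (Fin 2) F) : Prop :=
  ∀ i : ℕ, Subsingleton (groupHomology (Rep.of (linRep ρ)) i)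

/-- `ρ` and `ρ'` are conjugate by an element of `GL₂(F)`, that is, isomorphic over `F`. -/
def IsConjugate {G F : Type*} [Group G] [Field F]
    (ρ ρ' : G →* SpecialLinearGroup (Fin 2) F) : Prop :=
  ∃ P : GL (Fin 2) F, ∀ γ : G,
    (ρ' γ : Matrix (Fin 2) (Fin 2) F) =
      (P : Matrix (Fin 2) (Fin 2) F) * (ρ γ : Matrix (Fin 2) (Fin 2) F) *
        ((P⁻¹ : GL (Fin 2) F) : Matrix (Fin 2) (Fin 2) F)

/-- `ρ` corresponds to the point `(α, β)`: `tr ρ(a) = α` and `tr ρ(ab) = β`. -/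
def HasTraces {n : ℤ} {F : Type*} [Field F]
    (ρ : KnotGroup n →* SpecialLinearGroup (Fin 2) F) (α β : F) : Prop :=
  (ρ (genA n) : Matrix (Fin 2) (Fin 2) F).trace = α ∧
    (ρ (genA n * genB n) : Matrix (Fin 2) (Fin 2) F).trace = β

end TwistKnot

end

/-! On the diagonal, z + 2 = -x³ + 3x² is the product of -x and x² - 3x. If two sequences obey
three-term recurrences whose coefficients -x and x² - 3x alternate in opposite order, their product
therefore obeys a recurrence with coefficient z and a constant right-hand side, fixed by the initial
values (`recurrence_invariant`, `recurrence_mul`). Comparing initial values gives both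
factorizations. The Casoratian of g and h is -1, so they are coprime, and g n is prime to 2 because
its value at 0 is ±1; hence the factor k n is the greatest common divisor, in spite of the 2 in 2 h
k.

If A, B in SL₂ have common trace α and tr AB = β, then products and determinants of combinations of
1, A, B, AB depend only on α and β. In particular det (AB - BA) = 2 - z, so absolute irreducibility
means z ≠ 2; and A wⁿ - wⁿ B = f n (α, β) (A - B), so the relation of the group becomes f n = 0
(`mul_zpow_sub`). Irreducible pairs with the same traces are conjugate over the field itself
(`exists_intertwiner`).

Homology is computed by Fox calculus: with Λ the group algebra, Λ → Λ² → Λ is a free resolution of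
the trivial module. Middle exactness comes from a derivation into the cokernel (`exists_mul_fox`),
injectivity from the grading by degree and the infinite order of w for n ≠ 0
(`eq_zero_of_mul_foxA`). As det (A - B) = β + 2 - α² divides z - 2, it is nonzero for irreducible ρ,
and acyclicity then amounts to invertibility of the sum of the two Fox derivatives. Where f n = 0,
the determinant of that sum is τ n (α, β) (β + 2 - α²) (`det_foxSum`). No division by det (B - 1)
occurs, so α = 2 needs no separate treatment.

Finally f n = τ n = 0 with z ≠ 2 and 2 ≠ 0 forces β = α (`eq_of_fVal_of_τVal`), and coprimality of g
and h leaves k n (α) = 0. Conversely z - 2 = -(α - 2)² (α + 1) on the diagonal and k n (2) = ±1, so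
a root of k n gives an irreducible pair unless α = -1. The pair has entries in F because a certain
conic has a point over a finite field of odd characteristic. -/

open Polynomial

namespace TwistKnot

/-! ### The factorizations on the diagonal -/

/-- Two sequences indexed by `ℤ` that satisfy the same inhomogeneous three-term recurrence and agree
at `0` and `1` are equal. -/
theorem eq_of_recurrence {R : Type*} [CommRing R] {c e u v : ℤ → R}
    (hu : ∀ n, u (n + 1) - c n * u n + u (n - 1) = e n)
    (hv : ∀ n, v (n + 1) - c n * v n + v (n - 1) = e n)
    (h0 : u 0 = v 0) (h1 : u 1 = v 1) (n : ℤ) : u n = v n := by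
  suffices H : u n = v n ∧ u (n + 1) = v (n + 1) from H.1
  induction n using Int.induction_on with
  | zero => exact ⟨h0, by simpa using h1⟩
  | succ i ih =>
    refine ⟨ih.2, ?_⟩
    have hu' := hu (i + 1)
    have hv' := hv (i + 1)
    rw [add_sub_cancel_right] at hu' hv'
    linear_combination hu' - hv' + c (i + 1) * ih.2 - ih.1
  | pred i ih =>
    have hu' := hu (-i)
    have hv' := hv (-i)
    rw [sub_add_cancel]
    exact ⟨by linear_combination hu' - hv' + c (-i) * ih.1 - ih.2, ih.1⟩

/-- If `u` and `v` satisfy three-term recurrences whose coefficients alternate in opposite order,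
then this bilinear expression does not depend on `n`. -/
theorem recurrence_invariant {R : Type*} [CommRing R] {c c' u v : ℤ → R}
    (hc : ∀ n, c (n + 1) = c' n) (hc' : ∀ n, c' (n + 1) = c n)
    (hu : ∀ n, u (n + 1) - c n * u n + u (n - 1) = 0)
    (hv : ∀ n, v (n + 1) - c' n * v n + v (n - 1) = 0) (n : ℤ) :
    2 * (v n * u n) + 2 * (v (n - 1) * u (n - 1)) - c n * u n * v (n - 1) -
      c' n * v n * u (n - 1) =
    2 * (v 1 * u 1) + 2 * (v 0 * u 0) - c 1 * u 1 * v 0 - c' 1 * v 1 * u 0 := by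
  have step : ∀ m : ℤ, 2 * (v (m + 1) * u (m + 1)) + 2 * (v m * u m) -
      c (m + 1) * u (m + 1) * v m - c' (m + 1) * v (m + 1) * u m =
      2 * (v m * u m) + 2 * (v (m - 1) * u (m - 1)) - c m * u m * v (m - 1) -
      c' m * v m * u (m - 1) := by
    intro m
    have h1 : u (m + 1) = c m * u m - u (m - 1) := by linear_combination hu m
    have h2 : v (m + 1) = c' m * v m - v (m - 1) := by linear_combination hv m
    rw [hc, hc', h1, h2]
    ring
  have h1 := step 0
  rw [zero_add] at h1
  induction n using Int.induction_on with
  | zero => exact h1.symm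
  | succ i ih => rw [add_sub_cancel_right, step, ih]
  | pred i ih =>
    have h2 := step (-i - 1)
    rw [sub_add_cancel] at h2
    rw [← h2, ih]

/-- The recurrence for a product of two sequences as in `recurrence_invariant`. -/
theorem recurrence_mul {R : Type*} [CommRing R] {c c' u v : ℤ → R}
    (hc : ∀ n, c (n + 1) = c' n) (hc' : ∀ n, c' (n + 1) = c n)
    (hu : ∀ n, u (n + 1) - c n * u n + u (n - 1) = 0)
    (hv : ∀ n, v (n + 1) - c' n * v n + v (n - 1) = 0) (n : ℤ) :
    v (n + 1) * u (n + 1) - (c n * c' n - 2) * (v n * u n) + v (n - 1) * u (n - 1) =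
    2 * (v 1 * u 1) + 2 * (v 0 * u 0) - c 1 * u 1 * v 0 - c' 1 * v 1 * u 0 := by
  rw [← recurrence_invariant hc hc' hu hv n]
  have h1 : u (n + 1) = c n * u n - u (n - 1) := by linear_combination hu n
  have h2 : v (n + 1) = c' n * v n - v (n - 1) := by linear_combination hv n
  rw [h1, h2]
  ring

/-- The coefficients of the recurrence for `k`. -/
noncomputable def coeffK (m : ℤ) : ℤ[X] := if Even m then -X else X ^ 2 - 3 * X

/-- The coefficients of the recurrence for `g` and `h`. -/
noncomputable def coeffG (m : ℤ) : ℤ[X] := if Even m then X ^ 2 - 3 * X else -X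

theorem coeffK_add_one (m : ℤ) : coeffK (m + 1) = coeffG m := by
  by_cases hm : Even m <;> simp [coeffK, coeffG, hm]

theorem coeffG_add_one (m : ℤ) : coeffG (m + 1) = coeffK m := by
  by_cases hm : Even m <;> simp [coeffK, coeffG, hm]

theorem coeffK_mul_coeffG (m : ℤ) : coeffK m * coeffG m = -X ^ 3 + 3 * X ^ 2 := by
  by_cases hm : Even m <;> simp only [coeffK, coeffG, hm, if_true, if_false] <;> ring

theorem k_rec (m : ℤ) : k (m + 1) - coeffK m * k m + k (m - 1) = 0 := recSeq_rec _ _ _ m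

theorem g_rec (m : ℤ) : g (m + 1) - coeffG m * g m + g (m - 1) = 0 := recSeq_rec _ _ _ m

theorem h_rec (m : ℤ) : h (m + 1) - coeffG m * h m + h (m - 1) = 0 := recSeq_rec _ _ _ m

theorem k_zero : k 0 = -1 := recSeq_zero _ _ _
theorem k_one : k 1 = 1 := recSeq_one _ _ _
theorem g_zero : g 0 = -1 := recSeq_zero _ _ _
theorem g_one : g 1 = X - 1 := recSeq_one _ _ _
theorem h_zero : h 0 = 0 := recSeq_zero _ _ _
theorem h_one : h 1 = 1 := recSeq_one _ _ _

theorem coeffK_one : coeffK 1 = X ^ 2 - 3 * X := by simp [coeffK]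
theorem coeffG_one : coeffG 1 = -X := by simp [coeffG]

/-- The value of `z` on the diagonal. -/
noncomputable def diagZ : ℤ[X] := -X ^ 3 + 3 * X ^ 2 - 2

theorem diag_x : diag x = X := by simp [diag, x]
theorem diag_y : diag y = X := by simp [diag, y]

theorem diag_z : diag z = diagZ := by
  simp only [z, map_sub, map_add, map_mul, map_pow, diag_x, diag_y, map_ofNat, diagZ]
  ring

theorem diag_aeval_z (p : ℤ[X]) : diag (aeval z p) = aeval diagZ p := by
  rw [← diag_z, aeval_algHom_apply]

theorem diag_f (n : ℤ) :
    diag (f n) = (X - 1) * aeval diagZ (cheb n) - aeval diagZ (cheb (n - 1)) := by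
  simp only [f, map_sub, map_mul, map_one, diag_y, diag_aeval_z]

theorem diag_τ (n : ℤ) :
    diag (τ n) = (2 - X) * aeval diagZ (torsionQuot n) + X * aeval diagZ (cheb n) := by
  simp only [τ, map_add, map_sub, map_mul, map_ofNat, diag_x, diag_aeval_z]

/-- After multiplication by X - 2 the Chebyshev terms satisfy the homogeneous recurrence, and the
constant -2 contributes -2 (1 - X + 1) = 2 (X - 2). -/
theorem torsionQuot_rec (n : ℤ) :
    torsionQuot (n + 1) - X * torsionQuot n + torsionQuot (n - 1) = 2 := by
  have hX : (X - 2 : ℤ[X]) ≠ 0 := by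
    have := X_sub_C_ne_zero (R := ℤ) 2
    simpa using this
  apply mul_left_cancel₀ hX
  have h1 := torsionQuot_mul (n + 1)
  have h2 := torsionQuot_mul n
  have h3 := torsionQuot_mul (n - 1)
  have c1 := cheb_rec (n + 1)
  have c2 := cheb_rec (n - 1)
  rw [add_sub_cancel_right] at h1 c1
  rw [sub_add_cancel] at h3 c2
  linear_combination h1 - X * h2 + h3 + c1 - c2

theorem torsionQuot_zero : torsionQuot 0 = 0 := by
  have hX : (X - 2 : ℤ[X]) ≠ 0 := by
    have := X_sub_C_ne_zero (R := ℤ) 2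
    simpa using this
  apply mul_left_cancel₀ hX
  rw [torsionQuot_mul, zero_add, zero_sub, cheb_one, cheb_neg_one]
  ring

theorem torsionQuot_one : torsionQuot 1 = 1 := by
  have hX : (X - 2 : ℤ[X]) ≠ 0 := by
    have := X_sub_C_ne_zero (R := ℤ) 2
    simpa using this
  apply mul_left_cancel₀ hX
  have c1 := cheb_rec 1
  rw [torsionQuot_mul]
  rw [sub_self, cheb_zero, cheb_one] at *
  linear_combination c1

theorem aeval_cheb_rec {R : Type*} [CommRing R] [Algebra ℤ R] (t : R) (n : ℤ) :
    aeval t (cheb (n + 1)) - t * aeval t (cheb n) + aeval t (cheb (n - 1)) = 0 := by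
  have := congrArg (aeval t) (cheb_rec n)
  simpa using this

theorem aeval_torsionQuot_rec {R : Type*} [CommRing R] [Algebra ℤ R] (t : R) (n : ℤ) :
    aeval t (torsionQuot (n + 1)) - t * aeval t (torsionQuot n) +
      aeval t (torsionQuot (n - 1)) = 2 := by
  have := congrArg (aeval t) (torsionQuot_rec n)
  simpa only [map_add, map_sub, map_mul, aeval_X, map_ofNat] using this

/-- Since `coeffK m * coeffG m - 2` equals `diagZ`, both sides obey the same recurrence: for the
initial values of k and g the constant in `recurrence_mul` is 0. -/
theorem diag_f_eq (n : ℤ) : diag (f n) = g n * k n := by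
  refine eq_of_recurrence (u := fun n => diag (f n)) (v := fun n => g n * k n)
    (c := fun _ => diagZ) (e := fun _ => 0) (fun m => ?_) (fun m => ?_) ?_ ?_ n
  · have h1 := aeval_cheb_rec diagZ m
    have h2 := aeval_cheb_rec diagZ (m - 1)
    simp only [diag_f, add_sub_cancel_right]
    rw [sub_add_cancel] at h2
    linear_combination (X - 1) * h1 - h2
  · have h1 := recurrence_mul coeffK_add_one coeffG_add_one k_rec g_rec m
    rw [coeffK_mul_coeffG, k_one, k_zero, g_one, g_zero, coeffK_one, coeffG_one] at h1
    simp only [diagZ]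
    linear_combination h1
  · simp [diag_f, cheb_zero, cheb_neg_one, g_zero, k_zero]
  · simp [diag_f, cheb_zero, cheb_one, g_one, k_one]

/-- The constant for k and h is 2 - X. Its double is the inhomogeneous term 2 (2 - X) that
`torsionQuot_rec` produces for τ, which accounts for the factor 2. -/
theorem diag_τ_eq (n : ℤ) : diag (τ n) = 2 * h n * k n := by
  refine eq_of_recurrence (u := fun n => diag (τ n)) (v := fun n => 2 * h n * k n)
    (c := fun _ => diagZ) (e := fun _ => 2 * (2 - X)) (fun m => ?_) (fun m => ?_) ?_ ?_ n
  · have h1 := aeval_cheb_rec diagZ m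
    have h2 := aeval_torsionQuot_rec diagZ m
    simp only [diag_τ]
    linear_combination (2 - X) * h2 + X * h1
  · have h1 := recurrence_mul coeffK_add_one coeffG_add_one k_rec h_rec m
    rw [coeffK_mul_coeffG, k_one, k_zero, h_one, h_zero, coeffK_one, coeffG_one] at h1
    simp only [diagZ]
    linear_combination 2 * h1
  · simp [diag_τ, cheb_zero, torsionQuot_zero, h_zero]
  · simp only [diag_τ, cheb_one, torsionQuot_one, h_one, k_one, map_one]
    ring

/-! ### The Chebyshev form of `k` -/

/-- With t = 1 - x and s the Chebyshev sequence at t, two steps of k match three steps of s. The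
recurrences of k become s (m+1) + s (m-2) = (t - 1) (s m + s (m-1)) and s (m+2) + s (m+1) + s (m-1)
+ s (m-2) = (t² + t - 2) s m, where t - 1 = -x and t² + t - 2 = x² - 3x. -/
theorem k_eq_cheb (n : ℤ) :
    k (2 * n) = aeval (1 - X : ℤ[X]) (cheb (3 * n)) + aeval (1 - X : ℤ[X]) (cheb (3 * n - 1)) ∧
      k (2 * n + 1) = aeval (1 - X : ℤ[X]) (cheb (3 * n + 1)) := by
  have hrec : ∀ m, aeval (1 - X : ℤ[X]) (cheb (m + 1)) =
      (1 - X) * aeval (1 - X : ℤ[X]) (cheb m) - aeval (1 - X : ℤ[X]) (cheb (m - 1)) :=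
    fun m => by linear_combination aeval_cheb_rec (1 - X : ℤ[X]) m
  induction n using Int.induction_on with
  | zero => simp [k_zero, k_one, cheb_zero, cheb_one, cheb_neg_one]
  | succ i ih =>
    have e1 : (2 * (i + 1) : ℤ) - 1 = 2 * i + 1 := by ring
    have e2 : (2 * (i + 1) : ℤ) - 2 = 2 * i := by ring
    have k1 := k_rec_even (i + 1)
    have k2 := k_rec_odd (i + 1)
    have r1 := hrec (3 * i)
    have r2 := hrec (3 * i + 1)
    have r3 := hrec (3 * i + 1 + 1)
    have r4 := hrec (3 * i + 1 + 1 + 1)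
    have e3 : (3 * (i + 1) : ℤ) = 3 * i + 1 + 1 + 1 := by ring
    rw [e1, e2, ih.1, ih.2] at k1
    rw [e1, ih.2] at k2
    rw [e3]
    simp only [add_sub_cancel_right] at r1 r2 r3 r4 ⊢
    have k3 : k (2 * (i + 1)) = aeval (1 - X : ℤ[X]) (cheb (3 * i + 1 + 1 + 1)) +
        aeval (1 - X : ℤ[X]) (cheb (3 * i + 1 + 1)) := by
      rw [r3, r2]
      rw [r1] at k1 ⊢
      linear_combination k1
    refine ⟨k3, ?_⟩
    rw [k3] at k2
    rw [r4]
    rw [r3, r2] at k2 ⊢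
    linear_combination k2
  | pred i ih =>
    generalize (-i : ℤ) = j at *
    have e1 : (2 * j : ℤ) - 2 = 2 * (j - 1) := by ring
    have e2 : (2 * j : ℤ) - 1 = 2 * (j - 1) + 1 := by ring
    have k1 := k_rec_even j
    have k2 := k_rec_odd j
    rw [e2, ih.1, ih.2] at k2
    rw [e1, e2, ih.1] at k1
    have r1 := hrec (3 * j)
    have r2 := hrec (3 * j - 1)
    have r3 := hrec (3 * j - 1 - 1)
    have r4 := hrec (3 * j - 1 - 1 - 1)
    have e3 : (3 * (j - 1) : ℤ) = 3 * j - 1 - 1 - 1 := by ring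
    rw [e3]
    simp only [sub_add_cancel] at r1 r2 r3 r4 ⊢
    have k3 : k (2 * (j - 1) + 1) = aeval (1 - X : ℤ[X]) (cheb (3 * j - 1 - 1)) := by
      linear_combination k2 - r1 - r2
    refine ⟨?_, k3⟩
    rw [k3] at k1
    linear_combination k1 - r2 - r4 - (1 - X) * r3 - r3

/-! ### `k n` is the greatest common divisor -/

/-- The Casoratian of two solutions is constant, because the term of index n - 1 enters the
recurrence with coefficient 1. -/
theorem h_mul_g_sub (n : ℤ) : h n * g (n - 1) - g n * h (n - 1) = -1 := by
  have step : ∀ m : ℤ, h (m + 1) * g m - g (m + 1) * h m =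
      h m * g (m - 1) - g m * h (m - 1) := by
    intro m
    linear_combination g m * h_rec m - h m * g_rec m
  have h1 := step 0
  rw [zero_add, h_one, g_one, h_zero, g_zero] at h1
  induction n using Int.induction_on with
  | zero => rw [h_zero, g_zero, ← h1]; ring
  | succ i ih => rw [add_sub_cancel_right, step, ih]
  | pred i ih =>
    have h2 := step (-i - 1)
    rw [sub_add_cancel] at h2
    rw [← h2, ih]

theorem isCoprime_g_h (n : ℤ) : IsCoprime (g n) (h n) :=
  ⟨h (n - 1), -g (n - 1), by linear_combination -h_mul_g_sub n⟩

/-- Both coefficients of the recurrence vanish at 0, so a step of two only changes the sign. This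
excludes 2 as a divisor of g n. -/
theorem eval_zero_g_sq (n : ℤ) : (g n).eval 0 ^ 2 = 1 := by
  suffices H : (g n).eval 0 ^ 2 = 1 ∧ (g (n + 1)).eval 0 ^ 2 = 1 from H.1
  have step : ∀ m, (g (m + 1)).eval 0 = -(g (m - 1)).eval 0 := by
    intro m
    have := congrArg (eval 0) (g_rec m)
    have hc : (coeffG m).eval 0 = 0 := by
      by_cases hm : Even m <;> simp [coeffG, hm]
    simp only [eval_add, eval_sub, eval_mul, hc, eval_zero] at this
    linear_combination this
  induction n using Int.induction_on with
  | zero => simp [g_zero, g_one]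
  | succ i ih =>
    refine ⟨ih.2, ?_⟩
    rw [step, add_sub_cancel_right, neg_sq, ih.1]
  | pred i ih =>
    have h1 := step (-i)
    rw [sub_add_cancel]
    refine ⟨?_, ih.1⟩
    have h2 := ih.2
    rwa [h1, neg_sq] at h2

theorem isRelPrime_two_g (n : ℤ) : IsRelPrime (2 : ℤ[X]) (g n) := by
  have h2 : Prime (2 : ℤ[X]) := by
    have := Polynomial.prime_C_iff.mpr Int.prime_two
    simpa using this
  refine h2.irreducible.isRelPrime_iff_not_dvd.mpr ?_
  rintro ⟨q, hq⟩
  have := eval_zero_g_sq n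
  rw [hq] at this
  simp only [eval_mul, eval_ofNat] at this
  have : (2 : ℤ) ∣ 1 := ⟨2 * (q.eval 0) ^ 2, by rw [← this]; ring⟩
  omega

/-- Bézout for g and h gives d ∣ 2 k. Factor d = d₁ d₂ with d₁ ∣ 2 and k = d₂ q; cancelling d₂ in d
∣ g k leaves d₁ ∣ g q. Since d₁ divides 2 it is prime to g, so d₁ ∣ q and d ∣ k. -/
theorem dvd_k_of_dvd {n : ℤ} {d : ℤ[X]} (hf : d ∣ g n * k n) (hτ : d ∣ 2 * h n * k n) :
    d ∣ k n := by
  obtain ⟨u, v, huv⟩ := isCoprime_g_h n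
  have h2 : d ∣ 2 * k n := by
    have : 2 * k n = 2 * u * (g n * k n) + v * (2 * h n * k n) := by
      linear_combination -2 * k n * huv
    rw [this]
    exact dvd_add (hf.mul_left _) (hτ.mul_left _)
  rcases eq_or_ne (k n) 0 with hk | hk
  · exact hk ▸ dvd_zero d
  obtain ⟨d₁, d₂, hd₁, ⟨q, hq⟩, rfl⟩ := exists_dvd_and_dvd_of_dvd_mul h2
  have hd₂ : d₂ ≠ 0 := by
    rintro rfl
    exact hk (by rw [hq, zero_mul])
  have h3 : d₁ ∣ g n * q := by
    rw [hq, mul_comm d₁, mul_left_comm] at hf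
    exact (mul_dvd_mul_iff_left hd₂).mp hf
  have h4 : d₁ ∣ q := ((isRelPrime_two_g n).of_dvd_left hd₁).dvd_of_dvd_mul_left h3
  rw [hq, mul_comm d₁]
  exact mul_dvd_mul_left d₂ h4

end TwistKnot

namespace TwistKnot

open Matrix

/-! ### Pairs of `2 × 2` matrices -/

/-- The norm form of the algebra spanned by `1, A, B, AB`, where `A`, `B` have determinant `1`,
`tr A = tr B = α` and `tr (A B) = β`. -/
def normForm {R : Type*} [CommRing R] (α β q₀ q₁ q₂ q₃ : R) : R :=
  q₀ ^ 2 + q₁ ^ 2 + q₂ ^ 2 + q₃ ^ 2 + α * q₀ * q₁ + α * q₀ * q₂ + β * q₀ * q₃ +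
    (α ^ 2 - β) * q₁ * q₂ + α * q₁ * q₃ + α * q₂ * q₃

/-- The value of `z` at `(α, β)`. -/
def zVal {R : Type*} [CommRing R] (α β : R) : R := 2 * α ^ 2 - α ^ 2 * β + β ^ 2 - 2

/-- The value of `f n` at `(α, β)`. -/
noncomputable def fVal {R : Type*} [CommRing R] (n : ℤ) (α β : R) : R :=
  (β - 1) * aeval (zVal α β) (cheb n) - aeval (zVal α β) (cheb (n - 1))

/-- The value of `τ n` at `(α, β)`. -/
noncomputable def τVal {R : Type*} [CommRing R] (n : ℤ) (α β : R) : R :=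
  (2 - α) * aeval (zVal α β) (torsionQuot n) + α * aeval (zVal α β) (cheb n)

section Ring

variable {R : Type*} [CommRing R]

theorem zVal_sub_two (α β : R) : zVal α β - 2 = (β - 2) * (β + 2 - α ^ 2) := by
  rw [zVal]; ring

/-- This is det (gⁿ) = 1 for a matrix g of determinant 1 and trace t, written through `coe_zpow_eq`;
here it is proved as a conserved quantity of the recurrence. -/
theorem cheb_sq (t : R) (n : ℤ) :
    aeval t (cheb n) ^ 2 - t * aeval t (cheb n) * aeval t (cheb (n - 1)) +
      aeval t (cheb (n - 1)) ^ 2 = 1 := by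
  have step : ∀ m : ℤ, aeval t (cheb (m + 1)) ^ 2 - t * aeval t (cheb (m + 1)) *
      aeval t (cheb m) + aeval t (cheb m) ^ 2 = aeval t (cheb m) ^ 2 -
      t * aeval t (cheb m) * aeval t (cheb (m - 1)) + aeval t (cheb (m - 1)) ^ 2 := by
    intro m
    have h1 : aeval t (cheb (m + 1)) = t * aeval t (cheb m) - aeval t (cheb (m - 1)) := by
      linear_combination aeval_cheb_rec t m
    rw [h1]
    ring
  induction n using Int.induction_on with
  | zero => simp [cheb_zero, cheb_neg_one]
  | succ i ih => rw [add_sub_cancel_right, step, ih]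
  | pred i ih =>
    have h2 := step (-i - 1)
    rw [sub_add_cancel] at h2
    rw [← h2, ih]

theorem aeval_torsionQuot (t : R) (n : ℤ) : (t - 2) * aeval t (torsionQuot n) =
    t * aeval t (cheb n) - 2 * aeval t (cheb (n - 1)) - 2 := by
  have h1 := congrArg (aeval t) (torsionQuot_mul n)
  simp only [map_mul, map_sub, aeval_X, map_ofNat] at h1
  linear_combination h1 + aeval_cheb_rec t n

variable {A B : Matrix (Fin 2) (Fin 2) R} {α β : R}

/-- The determinant of 2 × 2 matrices is a quadratic form whose polar form is tr P tr Q - tr PQ, so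
only traces and determinants of A, B, AB enter. Later determinants reduce to polynomials in α and β
in this way. -/
theorem det_combination (hA : A.det = 1) (hB : B.det = 1) (tA : A.trace = α) (tB : B.trace = α)
    (tAB : (A * B).trace = β) (q₀ q₁ q₂ q₃ : R) :
    (q₀ • (1 : Matrix (Fin 2) (Fin 2) R) + q₁ • A + q₂ • B + q₃ • (A * B)).det =
      normForm α β q₀ q₁ q₂ q₃ := by
  have key : (q₀ • (1 : Matrix (Fin 2) (Fin 2) R) + q₁ • A + q₂ • B + q₃ • (A * B)).det =
      q₀ ^ 2 + q₁ ^ 2 * A.det + q₂ ^ 2 * B.det + q₃ ^ 2 * (A.det * B.det) +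
      A.trace * q₀ * q₁ + B.trace * q₀ * q₂ + (A * B).trace * q₀ * q₃ +
      (A.trace * B.trace - (A * B).trace) * q₁ * q₂ + A.det * B.trace * q₁ * q₃ +
      B.det * A.trace * q₂ * q₃ := by
    simp only [det_fin_two, trace_fin_two, Matrix.mul_apply, Fin.sum_univ_two, Matrix.add_apply,
      Matrix.smul_apply, smul_eq_mul, one_apply_eq, ne_eq, zero_ne_one, one_ne_zero,
      not_false_eq_true, one_apply_ne]
    ring
  rw [key, hA, hB, tA, tB, tAB, normForm]
  ring

theorem mul_self_eq (hA : A.det = 1) (tA : A.trace = α) : A * A = α • A - 1 := by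
  rw [← tA]
  rw [det_fin_two] at hA
  ext i j
  fin_cases i <;> fin_cases j <;>
    simp [Matrix.mul_apply, Fin.sum_univ_two, trace_fin_two] <;>
    first | linear_combination hA | linear_combination -hA | ring

/-- The polarization of the Cayley–Hamilton identity. -/
theorem mul_comm_eq (tA : A.trace = α) (tB : B.trace = α) (tAB : (A * B).trace = β) :
    B * A = α • A + α • B + (β - α ^ 2) • (1 : Matrix (Fin 2) (Fin 2) R) - A * B := by
  have h2 : (β - α ^ 2) = (A * B).trace - A.trace * B.trace := by rw [tA, tB, tAB]; ring
  rw [h2, show α • A = B.trace • A by rw [tB], show α • B = A.trace • B by rw [tA]]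
  ext i j
  fin_cases i <;> fin_cases j <;>
    simp [Matrix.mul_apply, Fin.sum_univ_two, trace_fin_two] <;> ring

end Ring

/-! ### Powers and commutators in SL₂, the relation of the group, and the Fox determinant. -/

section SpecialLinear

variable {R : Type*} [CommRing R]

theorem coe_mul_eq (g g' : SpecialLinearGroup (Fin 2) R) :
    ((g * g' : SpecialLinearGroup (Fin 2) R) : Matrix (Fin 2) (Fin 2) R) =
      (g : Matrix (Fin 2) (Fin 2) R) * (g' : Matrix (Fin 2) (Fin 2) R) := rfl

theorem coe_inv_eq_adjugate (g : SpecialLinearGroup (Fin 2) R) :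
    ((g⁻¹ : SpecialLinearGroup (Fin 2) R) : Matrix (Fin 2) (Fin 2) R) =
      adjugate (g : Matrix (Fin 2) (Fin 2) R) := rfl

theorem coe_inv_eq (g : SpecialLinearGroup (Fin 2) R) :
    ((g⁻¹ : SpecialLinearGroup (Fin 2) R) : Matrix (Fin 2) (Fin 2) R) =
      (g : Matrix (Fin 2) (Fin 2) R).trace • 1 - (g : Matrix (Fin 2) (Fin 2) R) := by
  rw [coe_inv_eq_adjugate]
  ext i j
  fin_cases i <;> fin_cases j <;> simp [adjugate_fin_two, trace_fin_two]

/-- By Cayley–Hamilton g⁻¹ = t - g, so each entry of gᵐ satisfies the Chebyshev recurrence at t. -/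
theorem coe_zpow_eq (g : SpecialLinearGroup (Fin 2) R) {t : R}
    (ht : (g : Matrix (Fin 2) (Fin 2) R).trace = t) (n : ℤ) :
    ((g ^ n : SpecialLinearGroup (Fin 2) R) : Matrix (Fin 2) (Fin 2) R) =
      aeval t (cheb n) • (g : Matrix (Fin 2) (Fin 2) R) - aeval t (cheb (n - 1)) • 1 := by
  have key : ∀ m : ℤ, ((g ^ (m + 1) : SpecialLinearGroup (Fin 2) R) :
      Matrix (Fin 2) (Fin 2) R) - t • ((g ^ m : SpecialLinearGroup (Fin 2) R) :
      Matrix (Fin 2) (Fin 2) R) + ((g ^ (m - 1) : SpecialLinearGroup (Fin 2) R) :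
      Matrix (Fin 2) (Fin 2) R) = 0 := by
    intro m
    rw [_root_.zpow_add_one, _root_.zpow_sub_one, coe_mul_eq, coe_mul_eq,
      coe_inv_eq, ht, mul_sub, Matrix.mul_smul, mul_one]
    abel
  ext i j
  refine eq_of_recurrence (c := fun _ => t) (e := fun _ => 0)
    (u := fun m => ((g ^ m : SpecialLinearGroup (Fin 2) R) : Matrix (Fin 2) (Fin 2) R) i j)
    (v := fun m => (aeval t (cheb m) • (g : Matrix (Fin 2) (Fin 2) R) -
      aeval t (cheb (m - 1)) • 1) i j) (fun m => ?_) (fun m => ?_) ?_ ?_ n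
  · have := congrFun (congrFun (key m) i) j
    simpa using this
  · have h1 := aeval_cheb_rec t m
    have h2 := aeval_cheb_rec t (m - 1)
    simp only [Matrix.sub_apply, Matrix.smul_apply, smul_eq_mul, add_sub_cancel_right]
    rw [sub_add_cancel] at h2
    linear_combination (g : Matrix (Fin 2) (Fin 2) R) i j * h1 -
      (1 : Matrix (Fin 2) (Fin 2) R) i j * h2
  · simp [cheb_zero, cheb_neg_one]
  · simp [cheb_zero, cheb_one]

variable {A B : SpecialLinearGroup (Fin 2) R} {α β : R}

local notation "M" => Matrix (Fin 2) (Fin 2) R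

/-- Here w = A (AB)⁻¹ B and (AB)⁻¹ = β - AB, so w = β AB - A² B². -/
theorem coe_commutator_eq (tA : (A : M).trace = α) (tB : (B : M).trace = α)
    (tAB : ((A : M) * (B : M)).trace = β) :
    ((A * B⁻¹ * A⁻¹ * B : SpecialLinearGroup (Fin 2) R) : M) =
      (β - α ^ 2) • ((A : M) * (B : M)) + α • (A : M) + α • (B : M) - 1 := by
  have h1 : A * B⁻¹ * A⁻¹ * B = A * (A * B)⁻¹ * B := by group
  rw [h1, coe_mul_eq, coe_mul_eq, coe_inv_eq,
    coe_mul_eq, tAB]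
  have h2 : (A : M) * (β • 1 - (A : M) * (B : M)) * (B : M) =
      β • ((A : M) * (B : M)) - ((A : M) * (A : M)) * ((B : M) * (B : M)) := by
    simp only [mul_sub, sub_mul, Matrix.mul_smul, Matrix.smul_mul, mul_one, mul_assoc]
  rw [h2, mul_self_eq A.2 tA, mul_self_eq B.2 tB]
  simp only [mul_sub, sub_mul, Matrix.mul_smul, Matrix.smul_mul, mul_one, one_mul]
  module

theorem trace_commutator (tA : (A : M).trace = α) (tB : (B : M).trace = α)
    (tAB : ((A : M) * (B : M)).trace = β) :
    ((A * B⁻¹ * A⁻¹ * B : SpecialLinearGroup (Fin 2) R) : M).trace = zVal α β := by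
  rw [coe_commutator_eq tA tB tAB]
  simp only [trace_sub, trace_add, trace_smul, tA, tB, tAB, trace_one, Fintype.card_fin,
    smul_eq_mul, zVal]
  push_cast
  ring

/-- Multiplication table in the algebra spanned by `1, A, B, AB`. -/
theorem mul_table (tA : (A : M).trace = α) (tB : (B : M).trace = α)
    (tAB : ((A : M) * (B : M)).trace = β) :
    (A : M) * (A : M) = α • (A : M) - 1 ∧ (B : M) * (B : M) = α • (B : M) - 1 ∧
    (B : M) * (A : M) = α • (A : M) + α • (B : M) + (β - α ^ 2) • (1 : M) - (A : M) * (B : M) ∧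
    (A : M) * ((A : M) * (B : M)) = α • ((A : M) * (B : M)) - (B : M) ∧
    (A : M) * (B : M) * (A : M) = β • (A : M) + (B : M) - α • (1 : M) ∧
    (A : M) * (B : M) * (B : M) = α • ((A : M) * (B : M)) - (A : M) ∧
    (A : M) * (B : M) * ((A : M) * (B : M)) = β • ((A : M) * (B : M)) - 1 ∧
    (B : M) * ((A : M) * (B : M)) = (A : M) + β • (B : M) - α • (1 : M) := by
  have hA := mul_self_eq A.2 tA
  have hB := mul_self_eq B.2 tB
  have hBA := mul_comm_eq tA tB tAB
  refine ⟨hA, hB, hBA, ?_, ?_, ?_, mul_self_eq (A * B).2 tAB, ?_⟩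
  · rw [← mul_assoc, hA, sub_mul, Matrix.smul_mul, one_mul]
  · rw [mul_assoc, hBA]
    simp only [mul_sub, mul_add, Matrix.mul_smul, mul_one, ← mul_assoc]
    rw [hA, sub_mul, Matrix.smul_mul, one_mul]
    module
  · rw [mul_assoc, hB, mul_sub, Matrix.mul_smul, mul_one]
  · rw [← mul_assoc, hBA]
    simp only [sub_mul, add_mul, Matrix.smul_mul, one_mul, mul_assoc, hB, mul_sub,
      Matrix.mul_smul, mul_one]
    module

/-- Writing wⁿ = s w - s' reduces this to A w - w B = (β - 1) (A - B). For A ≠ B over a field, the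
single scalar equation f n = 0 thus expresses the relation of the group. -/
theorem mul_zpow_sub (tA : (A : M).trace = α) (tB : (B : M).trace = α)
    (tAB : ((A : M) * (B : M)).trace = β) (n : ℤ) :
    (A : M) * (((A * B⁻¹ * A⁻¹ * B) ^ n : SpecialLinearGroup (Fin 2) R) : M) -
      (((A * B⁻¹ * A⁻¹ * B) ^ n : SpecialLinearGroup (Fin 2) R) : M) * (B : M) =
      fVal n α β • ((A : M) - (B : M)) := by
  obtain ⟨hAA, hBB, hBA, hAE, hEA, hEB, hEE, hBE⟩ := mul_table tA tB tAB
  rw [coe_zpow_eq _ (trace_commutator tA tB tAB), coe_commutator_eq tA tB tAB, fVal]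
  generalize aeval (zVal α β) (cheb n) = s
  generalize aeval (zVal α β) (cheb (n - 1)) = s'
  simp only [mul_sub, mul_add, sub_mul, add_mul, Matrix.mul_smul, Matrix.smul_mul, mul_one,
    one_mul, hAA, hBB, hAE, hEB]
  module

/-- The determinant of the sum of the two Fox derivatives, for `W = 1 + w + ⋯ + wⁿ⁻¹`. -/
theorem det_foxSum [IsDomain R] (tA : (A : M).trace = α) (tB : (B : M).trace = α)
    (tAB : ((A : M) * (B : M)).trace = β) (n : ℤ) (hf : fVal n α β = 0) (hz : zVal α β ≠ 2)
    (W : M) (hW : W * (((A * B⁻¹ * A⁻¹ * B : SpecialLinearGroup (Fin 2) R) : M) - 1) =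
      (((A * B⁻¹ * A⁻¹ * B) ^ n : SpecialLinearGroup (Fin 2) R) : M) - 1) :
    (1 - (((A * B⁻¹ * A⁻¹ * B) ^ n : SpecialLinearGroup (Fin 2) R) : M) +
      ((A : M) - 1) * W * (1 - (A : M) * ((B⁻¹ : SpecialLinearGroup (Fin 2) R) : M))).det =
      τVal n α β * (β + 2 - α ^ 2) := by
  obtain ⟨hAA, hBB, hBA, hAE, hEA, hEB, hEE, hBE⟩ := mul_table tA tB tAB
  have hw := mul_self_eq (A * B⁻¹ * A⁻¹ * B).2 (trace_commutator tA tB tAB)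
  rw [coe_zpow_eq _ (trace_commutator tA tB tAB)] at hW ⊢
  rw [τVal]
  rw [fVal] at hf
  have hN := cheb_sq (zVal α β) n
  have hq := aeval_torsionQuot (zVal α β) n
  generalize aeval (zVal α β) (cheb n) = s at *
  generalize aeval (zVal α β) (cheb (n - 1)) = s' at *
  generalize aeval (zVal α β) (torsionQuot n) = q at *
  have hwe := coe_commutator_eq tA tB tAB
  generalize ((A * B⁻¹ * A⁻¹ * B : SpecialLinearGroup (Fin 2) R) : M) = w at *
  set ζ := zVal α β with hζ
  have hD : ζ - 2 ≠ 0 := sub_ne_zero.mpr hz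
  have hs : s' = (β - 1) * s := by linear_combination -hf
  subst hs
  -- From w² = ζ w - 1: up to the scalar ζ - 2 this inverts w - 1, which determines W from `hW`.
  have hinv : (w - 1) * (w - (ζ - 1) • 1) = (ζ - 2) • (1 : M) := by
    simp only [mul_sub, sub_mul, Matrix.mul_smul, mul_one, one_mul, hw]
    module
  have hW' : (ζ - 2) • W = ((2 - β) * s - 1) • w +
      ((ζ - 1) * ((β - 1) * s + 1) - s) • (1 : M) := by
    have h1 : (ζ - 2) • W = W * (w - 1) * (w - (ζ - 1) • 1) := by
      rw [mul_assoc, hinv, Matrix.mul_smul, mul_one]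
    rw [h1, hW]
    simp only [mul_sub, sub_mul, Matrix.mul_smul, Matrix.smul_mul, mul_one, one_mul, hw]
    module
  have hP : 1 - (A : M) * ((B⁻¹ : SpecialLinearGroup (Fin 2) R) : M) =
      (1 : M) - α • (A : M) + (A : M) * (B : M) := by
    rw [coe_inv_eq, tB, mul_sub, Matrix.mul_smul, mul_one]
    module
  have hwP : w * ((1 : M) - α • (A : M) + (A : M) * (B : M)) =
      (α ^ 2 - β - 1) • (1 : M) + (α * (1 - ζ)) • (A : M) +
        (β + ζ + 1 - α ^ 2) • ((A : M) * (B : M)) := by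
    rw [hwe, hζ, zVal]
    simp only [mul_sub, mul_add, sub_mul, add_mul, Matrix.mul_smul, Matrix.smul_mul, mul_one,
      one_mul, hAA, hBA, hAE, hEA, hEE, hBE]
    module
  set T := (2 - β) * s - 1 with hT
  set U := (ζ - 1) * ((β - 1) * s + 1) - s with hU
  -- Coordinates on 1, A, B, AB, so that `det_combination` applies; the factor ζ - 2 clears the
  -- denominator of W.
  have hsum : (ζ - 2) • (1 - (s • w - ((β - 1) * s) • 1) +
      ((A : M) - 1) * W * (1 - (A : M) * ((B⁻¹ : SpecialLinearGroup (Fin 2) R) : M))) =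
      ((ζ - 2) * (1 + (β - 1) * s + s) + T * (α * ζ - α - α ^ 2 + β + 1) +
        U * (α - 1)) • (1 : M) +
      ((ζ - 2) * (-s * α) + T * (2 * α ^ 2 - β - 1 - α ^ 2 * ζ - α + α * ζ) +
        U * (1 + α - α ^ 2)) • (A : M) +
      ((ζ - 2) * (-s * α) - T * (β + ζ + 1 - α ^ 2) - U) • (B : M) +
      ((ζ - 2) * (-s * (β - α ^ 2)) + T * ((α - 1) * (β + ζ + 1 - α ^ 2)) +
        U * (α - 1)) • ((A : M) * (B : M)) := by
    have h1 : (ζ - 2) • (((A : M) - 1) * W *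
        (1 - (A : M) * ((B⁻¹ : SpecialLinearGroup (Fin 2) R) : M))) =
        ((A : M) - 1) * (T • (w * ((1 : M) - α • (A : M) + (A : M) * (B : M))) +
          U • ((1 : M) - α • (A : M) + (A : M) * (B : M))) := by
      rw [hP, ← Matrix.smul_mul, ← Matrix.mul_smul, hW', mul_assoc, add_mul, Matrix.smul_mul,
        Matrix.smul_mul, one_mul]
    rw [smul_add, h1, hwP, hwe]
    simp only [mul_sub, mul_add, sub_mul, Matrix.mul_smul, mul_one, one_mul, hAA, hAE]
    module
  have hdet := congrArg Matrix.det hsum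
  rw [det_combination A.2 B.2 tA tB tAB, det_smul, Fintype.card_fin] at hdet
  refine mul_left_cancel₀ (pow_ne_zero 2 hD) (hdet.trans ?_)
  have hz2 := zVal_sub_two α β
  rw [← hζ] at hz2
  have h2 : (ζ - 2) ^ 2 * (((2 - α) * q + α * s) * (β + 2 - α ^ 2)) =
      (ζ - 2) * ((2 - α) * (ζ * s - 2 * ((β - 1) * s) - 2) + α * (ζ - 2) * s) *
        (β + 2 - α ^ 2) := by
    linear_combination (ζ - 2) * (2 - α) * (β + 2 - α ^ 2) * hq
  rw [h2, hT, hU]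
  have hζ' : ζ = 2 * α ^ 2 - α ^ 2 * β + β ^ 2 - 2 := hζ
  clear_value ζ
  subst hζ'
  -- Both sides are quadratic in s, and `hN` has the form c s² = 1. The multiplier is the right side
  -- minus the left side at s = 0, where T = -1 and U = ζ - 1.
  linear_combination (norm := skip) ((-2) * ((β - 2) * (β + 2 - α ^ 2)) * (2 - α) * (β + 2 - α ^ 2) -
    normForm α β
      ((β - 2) * (β + 2 - α ^ 2) -
        (α * (2 * α ^ 2 - α ^ 2 * β + β ^ 2 - 2) - α - α ^ 2 + β + 1) +
        (2 * α ^ 2 - α ^ 2 * β + β ^ 2 - 3) * (α - 1))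
      (-(2 * α ^ 2 - β - 1 - α ^ 2 * (2 * α ^ 2 - α ^ 2 * β + β ^ 2 - 2) - α +
        α * (2 * α ^ 2 - α ^ 2 * β + β ^ 2 - 2)) +
        (2 * α ^ 2 - α ^ 2 * β + β ^ 2 - 3) * (1 + α - α ^ 2))
      ((β + (2 * α ^ 2 - α ^ 2 * β + β ^ 2 - 2) + 1 - α ^ 2) -
        (2 * α ^ 2 - α ^ 2 * β + β ^ 2 - 3))
      (-((α - 1) * (β + (2 * α ^ 2 - α ^ 2 * β + β ^ 2 - 2) + 1 - α ^ 2)) +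
        (2 * α ^ 2 - α ^ 2 * β + β ^ 2 - 3) * (α - 1))) * hN
  simp only [normForm]
  ring

end SpecialLinear
end TwistKnot

namespace TwistKnot

open Matrix

/-- An elimination of s and s'. From f = 0, s' = (β - 1) s; then τ = 0, after division by 2, is the
linear equation s (2 - β) (α² - α - β) = 2 - α, and `cheb_sq` becomes s² (2 - β) (β² + α² - α² β) =
1. Eliminating s leaves (2 - β) (β - α)² (β + 2 - α²) = 0, whose outer factors are nonzero because
their product is 2 - z. -/
theorem eq_of_fVal_of_τVal {F : Type*} [Field F] (h2 : (2 : F) ≠ 0) {n : ℤ} {α β : F}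
    (hf : fVal n α β = 0) (hτ : τVal n α β = 0) (hz : zVal α β ≠ 2) : β = α := by
  rw [fVal] at hf
  rw [τVal] at hτ
  have hN := cheb_sq (zVal α β) n
  have hq := aeval_torsionQuot (zVal α β) n
  generalize aeval (zVal α β) (cheb n) = s at *
  generalize aeval (zVal α β) (cheb (n - 1)) = s' at *
  generalize aeval (zVal α β) (torsionQuot n) = q at *
  have hz2 := zVal_sub_two α β
  have hD : (β - 2) * (β + 2 - α ^ 2) ≠ 0 := hz2 ▸ sub_ne_zero.mpr hz
  have hs : s' = (β - 1) * s := by linear_combination -hf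
  subst hs
  have h1 : s * ((2 - β) * (α ^ 2 - α - β)) = 2 - α := by
    apply mul_left_cancel₀ h2
    rw [zVal] at hq
    linear_combination -(2 - α) * hq + (2 * α ^ 2 - α ^ 2 * β + β ^ 2 - 4) * hτ
  have h3 : (β - α) ^ 2 * (β + 2 - α ^ 2) = 0 := by
    have h4 : (2 - β) * ((β - α) ^ 2 * (β + 2 - α ^ 2)) = 0 := by
      rw [zVal] at hN
      linear_combination -(s * ((2 - β) * (α ^ 2 - α - β)) + 2 - α) *
        ((2 - β) * (β ^ 2 + α ^ 2 - α ^ 2 * β)) * h1 +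
        ((2 - β) * (α ^ 2 - α - β)) ^ 2 * hN
    refine (mul_eq_zero.mp h4).resolve_left fun h => left_ne_zero_of_mul hD ?_
    linear_combination -h
  have h5 := (mul_eq_zero.mp h3).resolve_right (right_ne_zero_of_mul hD)
  exact sub_eq_zero.mp (pow_eq_zero_iff two_ne_zero |>.mp h5)

/-! ### Vectors in the plane -/

section Plane

variable {F : Type*} [Field F]

/-- The determinant of the matrix with columns `v` and `u`. -/
def det₂ (v u : Fin 2 → F) : F := v 0 * u 1 - v 1 * u 0

theorem exists_smul_of_det₂_eq_zero {v u : Fin 2 → F} (hv : v ≠ 0) (h : det₂ v u = 0) :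
    ∃ c : F, u = c • v := by
  rw [det₂] at h
  by_cases h0 : v 0 = 0
  · have h1 : v 1 ≠ 0 := by
      intro h1
      exact hv (by ext i; fin_cases i <;> assumption)
    refine ⟨u 1 / v 1, ?_⟩
    ext i
    fin_cases i
    · rw [h0, zero_mul, zero_sub, neg_eq_zero, mul_eq_zero] at h
      simp [h0, h.resolve_left h1]
    · simp [h1]
  · refine ⟨u 0 / v 0, ?_⟩
    ext i
    fin_cases i
    · simp [h0]
    · simp only [Fin.mk_one, Pi.smul_apply, smul_eq_mul]
      field_simp
      linear_combination h

theorem eq_combination_of_det₂_ne_zero {v u : Fin 2 → F} (h : det₂ v u ≠ 0) (x : Fin 2 → F) :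
    x = (det₂ x u / det₂ v u) • v + (det₂ v x / det₂ v u) • u := by
  ext i
  simp only [Pi.add_apply, Pi.smul_apply, smul_eq_mul]
  field_simp
  fin_cases i <;> simp only [det₂, Fin.zero_eta, Fin.mk_one] <;> ring

/-- Otherwise v would be a common eigenvector, hence in the kernel of AB - BA. -/
theorem det₂_mulVec_ne_zero {A B : Matrix (Fin 2) (Fin 2) F} (h : (A * B - B * A).det ≠ 0)
    {v : Fin 2 → F} (hv : v ≠ 0) : det₂ v (A *ᵥ v) ≠ 0 ∨ det₂ v (B *ᵥ v) ≠ 0 := by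
  by_contra! H
  obtain ⟨c, hc⟩ := exists_smul_of_det₂_eq_zero hv H.1
  obtain ⟨d, hd⟩ := exists_smul_of_det₂_eq_zero hv H.2
  refine h (Matrix.exists_mulVec_eq_zero_iff.mp ⟨v, hv, ?_⟩)
  rw [sub_mulVec, ← mulVec_mulVec, ← mulVec_mulVec, hc, hd, mulVec_smul, mulVec_smul, hc, hd,
    smul_comm, sub_self]

theorem mem_of_det₂_ne_zero {W : Submodule F (Fin 2 → F)} {v u : Fin 2 → F} (hv : v ∈ W)
    (hu : u ∈ W) (h : det₂ v u ≠ 0) (x : Fin 2 → F) : x ∈ W := by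
  rw [eq_combination_of_det₂_ne_zero h x]
  exact W.add_mem (W.smul_mem _ hv) (W.smul_mem _ hu)

theorem eq_top_of_invariant {A B : Matrix (Fin 2) (Fin 2) F} (h : (A * B - B * A).det ≠ 0)
    {W : Submodule F (Fin 2 → F)} (hA : ∀ v ∈ W, A *ᵥ v ∈ W) (hB : ∀ v ∈ W, B *ᵥ v ∈ W)
    (hW : W ≠ ⊥) : W = ⊤ := by
  obtain ⟨v, hv, hv0⟩ := W.exists_mem_ne_zero_of_ne_bot hW
  rw [Submodule.eq_top_iff']
  rcases det₂_mulVec_ne_zero h hv0 with h' | h'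
  · exact mem_of_det₂_ne_zero hv (hA v hv) h'
  · exact mem_of_det₂_ne_zero hv (hB v hv) h'

theorem exists_eigenvector [IsAlgClosed F] (A : Matrix (Fin 2) (Fin 2) F) :
    ∃ (c : F) (v : Fin 2 → F), v ≠ 0 ∧ A *ᵥ v = c • v := by
  obtain ⟨c, hc⟩ := Module.End.exists_eigenvalue (Matrix.toLin' A)
  obtain ⟨v, hv⟩ := hc.exists_hasEigenvector
  exact ⟨c, v, hv.2, by simpa using hv.apply_eq_smul⟩

end Plane

/-! ### Irreducibility -/

section Irreducible

variable {G F : Type*} [Group G] [Field F]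

theorem isIrreducible_of_det_ne_zero (ρ : G →* SpecialLinearGroup (Fin 2) F) (a b : G)
    (h : ((ρ a : Matrix (Fin 2) (Fin 2) F) * (ρ b : Matrix (Fin 2) (Fin 2) F) -
      (ρ b : Matrix (Fin 2) (Fin 2) F) * (ρ a : Matrix (Fin 2) (Fin 2) F)).det ≠ 0) :
    (linRep ρ).IsIrreducible where
  exists_pair_ne := by
    refine ⟨⊥, ⊤, fun H => ?_⟩
    have h1 : (fun _ => 1 : Fin 2 → F) ∈ (⊥ : Subrepresentation (linRep ρ)) := by
      rw [H]; trivial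
    have h2 : (fun _ => 1 : Fin 2 → F) = 0 := h1
    exact one_ne_zero (congrFun h2 0)
  eq_bot_or_eq_top W := by
    by_cases hW : W.toSubmodule = ⊥
    · left
      exact Subrepresentation.toSubmodule_injective hW
    · right
      refine Subrepresentation.toSubmodule_injective (eq_top_of_invariant h ?_ ?_ hW)
      · intro v hv
        exact W.apply_mem_toSubmodule a hv
      · intro v hv
        exact W.apply_mem_toSubmodule b hv

/-- N A = N' N makes ker N stable under A. Stability passes to inverses because g⁻¹ = tr g - g, and
ker N is proper and nonzero. -/
theorem not_isIrreducible_of_ker (ρ : G →* SpecialLinearGroup (Fin 2) F) {a b : G}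
    (hG : Subgroup.closure {a, b} = ⊤) {N : Matrix (Fin 2) (Fin 2) F} (hN : N ≠ 0)
    (hdet : N.det = 0)
    (hA : ∃ N', N * (ρ a : Matrix (Fin 2) (Fin 2) F) = N' * N)
    (hB : ∃ N', N * (ρ b : Matrix (Fin 2) (Fin 2) F) = N' * N) :
    ¬ (linRep ρ).IsIrreducible := by
  intro hirr
  have key : ∀ γ : G, ∀ v, N *ᵥ v = 0 → N *ᵥ ((ρ γ : Matrix (Fin 2) (Fin 2) F) *ᵥ v) = 0 := by
    intro γ
    have hγ : γ ∈ Subgroup.closure {a, b} := hG ▸ Subgroup.mem_top γ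
    induction hγ using Subgroup.closure_induction with
    | mem g hg =>
      intro v hv
      rcases hg with rfl | rfl
      · obtain ⟨N', h⟩ := hA
        rw [mulVec_mulVec, h, ← mulVec_mulVec, hv, mulVec_zero]
      · obtain ⟨N', h⟩ := hB
        rw [mulVec_mulVec, h, ← mulVec_mulVec, hv, mulVec_zero]
    | one =>
      intro v hv
      rw [map_one]
      simpa using hv
    | mul g g' _ _ ih ih' =>
      intro v hv
      rw [map_mul, coe_mul_eq, ← mulVec_mulVec]
      exact ih _ (ih' _ hv)
    | inv g _ ih =>
      intro v hv
      rw [map_inv, coe_inv_eq, sub_mulVec, smul_mulVec, one_mulVec, mulVec_sub, mulVec_smul, hv,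
        ih v hv, smul_zero, sub_zero]
  let W : Subrepresentation (linRep ρ) :=
    { toSubmodule := LinearMap.ker (Matrix.mulVecLin N)
      apply_mem_toSubmodule := fun γ v hv => key γ v hv }
  rcases hirr.eq_bot_or_eq_top W with h | h
  · obtain ⟨v, hv, hv0⟩ := Matrix.exists_mulVec_eq_zero_iff.mpr hdet
    have h1 : v ∈ W := hv0
    rw [h] at h1
    exact hv h1
  · refine hN (Matrix.ext_of_mulVec_single fun i => ?_)
    have h1 : (Pi.single i 1 : Fin 2 → F) ∈ W := by rw [h]; trivial
    have h2 : N *ᵥ (Pi.single i 1) = 0 := h1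
    rw [h2, zero_mulVec]

theorem not_isIrreducible_of_det_eq_zero [IsAlgClosed F] (ρ : G →* SpecialLinearGroup (Fin 2) F)
    {a b : G} (hG : Subgroup.closure {a, b} = ⊤)
    (h : ((ρ a : Matrix (Fin 2) (Fin 2) F) * (ρ b : Matrix (Fin 2) (Fin 2) F) -
      (ρ b : Matrix (Fin 2) (Fin 2) F) * (ρ a : Matrix (Fin 2) (Fin 2) F)).det = 0) :
    ¬ (linRep ρ).IsIrreducible := by
  obtain ⟨N, hN, hdet, hA, hB⟩ : ∃ N : Matrix (Fin 2) (Fin 2) F, N ≠ 0 ∧ N.det = 0 ∧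
      (∃ N', N * (ρ a : Matrix (Fin 2) (Fin 2) F) = N' * N) ∧
      (∃ N', N * (ρ b : Matrix (Fin 2) (Fin 2) F) = N' * N) := by
    generalize (ρ a : Matrix (Fin 2) (Fin 2) F) = A at *
    generalize (ρ b : Matrix (Fin 2) (Fin 2) F) = B at *
    by_cases hC : A * B - B * A = 0
    · have hcomm : A * B = B * A := sub_eq_zero.mp hC
      have eig : ∀ D : Matrix (Fin 2) (Fin 2) F, ∃ c : F, (D - c • 1).det = 0 := by
        intro D
        obtain ⟨c, v, hv, hc⟩ := exists_eigenvector D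
        refine ⟨c, Matrix.exists_mulVec_eq_zero_iff.mp ⟨v, hv, ?_⟩⟩
        rw [sub_mulVec, hc, smul_mulVec, one_mulVec, sub_self]
      obtain ⟨c, hc⟩ := eig A
      obtain ⟨d, hd⟩ := eig B
      by_cases hA : A - c • 1 = 0
      · by_cases hB : B - d • 1 = 0
        · rw [sub_eq_zero] at hA hB
          refine ⟨!![1, 0; 0, 0], ?_, by simp, ⟨c • 1, ?_⟩, ⟨d • 1, ?_⟩⟩
          · intro H
            simpa using congrFun (congrFun H 0) 0
          · rw [hA]; simp
          · rw [hB]; simp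
        · refine ⟨_, hB, hd, ⟨A, ?_⟩, ⟨B, ?_⟩⟩ <;>
            simp [sub_mul, mul_sub, hcomm]
      · refine ⟨_, hA, hc, ⟨A, ?_⟩, ⟨B, ?_⟩⟩ <;>
          simp [sub_mul, mul_sub, hcomm]
    -- The commutator C itself serves as N: tr C = tr CA = tr CB = 0 give C A = adj(A) C and C B =
    -- adj(B) C.
    · refine ⟨_, hC, h, ⟨adjugate A, ?_⟩, ⟨adjugate B, ?_⟩⟩ <;>
      · ext i j
        fin_cases i <;> fin_cases j <;>
          simp [Matrix.mul_apply, Fin.sum_univ_two, adjugate_fin_two] <;> ring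
  exact not_isIrreducible_of_ker ρ hG hN hdet hA hB

/-- The criterion is the nonvanishing of a determinant, which is insensitive to extension of the
field. -/
theorem isAbsIrreducible_iff (ρ : G →* SpecialLinearGroup (Fin 2) F) {a b : G}
    (hG : Subgroup.closure {a, b} = ⊤) : IsAbsIrreducible ρ ↔
    ((ρ a : Matrix (Fin 2) (Fin 2) F) * (ρ b : Matrix (Fin 2) (Fin 2) F) -
      (ρ b : Matrix (Fin 2) (Fin 2) F) * (ρ a : Matrix (Fin 2) (Fin 2) F)).det ≠ 0 := by
  set ρ' := (SpecialLinearGroup.map (algebraMap F (AlgebraicClosure F))).comp ρ with hρ'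
  have key : ((ρ' a : Matrix (Fin 2) (Fin 2) (AlgebraicClosure F)) * (ρ' b : Matrix _ _ _) -
      (ρ' b : Matrix (Fin 2) (Fin 2) (AlgebraicClosure F)) * (ρ' a : Matrix _ _ _)).det =
      algebraMap F (AlgebraicClosure F) ((ρ a : Matrix (Fin 2) (Fin 2) F) * (ρ b : Matrix _ _ _) -
      (ρ b : Matrix (Fin 2) (Fin 2) F) * (ρ a : Matrix _ _ _)).det := by
    rw [RingHom.map_det, map_sub, map_mul, map_mul]
    rfl
  constructor
  · intro h h0
    rw [h0, map_zero] at key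
    exact not_isIrreducible_of_det_eq_zero ρ' hG key h
  · intro h
    refine isIrreducible_of_det_ne_zero ρ' a b ?_
    rw [key]
    simpa using h

theorem det_mul_sub_mul {A B : SpecialLinearGroup (Fin 2) F} {α β : F}
    (tA : (A : Matrix (Fin 2) (Fin 2) F).trace = α) (tB : (B : Matrix (Fin 2) (Fin 2) F).trace = α)
    (tAB : ((A : Matrix (Fin 2) (Fin 2) F) * (B : Matrix (Fin 2) (Fin 2) F)).trace = β) :
    ((A : Matrix (Fin 2) (Fin 2) F) * (B : Matrix (Fin 2) (Fin 2) F) -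
      (B : Matrix (Fin 2) (Fin 2) F) * (A : Matrix (Fin 2) (Fin 2) F)).det = 2 - zVal α β := by
  have h : (A : Matrix (Fin 2) (Fin 2) F) * (B : Matrix (Fin 2) (Fin 2) F) -
      (B : Matrix (Fin 2) (Fin 2) F) * (A : Matrix (Fin 2) (Fin 2) F) =
      (α ^ 2 - β) • (1 : Matrix (Fin 2) (Fin 2) F) + (-α) • (A : Matrix (Fin 2) (Fin 2) F) +
      (-α) • (B : Matrix (Fin 2) (Fin 2) F) +
      (2 : F) • ((A : Matrix (Fin 2) (Fin 2) F) * (B : Matrix (Fin 2) (Fin 2) F)) := by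
    rw [mul_comm_eq tA tB tAB]
    module
  rw [h, det_combination A.2 B.2 tA tB tAB, normForm, zVal]
  ring

theorem det_sub {A B : SpecialLinearGroup (Fin 2) F} {α β : F}
    (tA : (A : Matrix (Fin 2) (Fin 2) F).trace = α) (tB : (B : Matrix (Fin 2) (Fin 2) F).trace = α)
    (tAB : ((A : Matrix (Fin 2) (Fin 2) F) * (B : Matrix (Fin 2) (Fin 2) F)).trace = β) :
    ((A : Matrix (Fin 2) (Fin 2) F) - (B : Matrix (Fin 2) (Fin 2) F)).det = β + 2 - α ^ 2 := by
  have h : (A : Matrix (Fin 2) (Fin 2) F) - (B : Matrix (Fin 2) (Fin 2) F) =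
      (0 : F) • (1 : Matrix (Fin 2) (Fin 2) F) + (1 : F) • (A : Matrix (Fin 2) (Fin 2) F) +
      (-1 : F) • (B : Matrix (Fin 2) (Fin 2) F) +
      (0 : F) • ((A : Matrix (Fin 2) (Fin 2) F) * (B : Matrix (Fin 2) (Fin 2) F)) := by
    module
  rw [h, det_combination A.2 B.2 tA tB tAB, normForm]
  ring

end Irreducible

end TwistKnot

namespace TwistKnot

open Matrix

/-! ### Pairs of matrices up to conjugation -/

section Conjugation

variable {F : Type*} [Field F]

/-- A normal form for a pair of matrices without common eigenvector. -/
theorem exists_normalForm [IsAlgClosed F] {A B : Matrix (Fin 2) (Fin 2) F} {α β : F}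
    (hA : A.det = 1) (hB : B.det = 1) (tA : A.trace = α) (tB : B.trace = α)
    (tAB : (A * B).trace = β) (h : (A * B - B * A).det ≠ 0) {c : F} (hc : c ^ 2 - α * c + 1 = 0) :
    ∃ Q : Matrix (Fin 2) (Fin 2) F, Q.det ≠ 0 ∧
      A * Q = Q * !![c, β - (α - c) * α; 0, α - c] ∧ B * Q = Q * !![0, -1; 1, α] := by
  have hdet : (A - c • 1).det = 0 := by
    rw [det_fin_two] at hA ⊢
    rw [trace_fin_two] at tA
    simp only [Matrix.sub_apply, Matrix.smul_apply, smul_eq_mul, one_apply_eq, ne_eq, zero_ne_one, one_ne_zero,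
      not_false_eq_true, one_apply_ne]
    linear_combination hA + hc - c * tA
  obtain ⟨v, hv, hAv⟩ := Matrix.exists_mulVec_eq_zero_iff.mpr hdet
  rw [sub_mulVec, smul_mulVec, one_mulVec, sub_eq_zero] at hAv
  have hBv : det₂ v (B *ᵥ v) ≠ 0 := by
    refine (det₂_mulVec_ne_zero h hv).resolve_left fun H => H ?_
    rw [hAv]
    simp only [det₂, Pi.smul_apply, smul_eq_mul]
    ring
  set Q : Matrix (Fin 2) (Fin 2) F := of fun i j => if j = 0 then v i else (B *ᵥ v) i with hQ
  have hQ0 : ∀ i, Q i 0 = v i := fun i => rfl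
  have hQ1 : ∀ i, Q i 1 = (B *ᵥ v) i := fun i => rfl
  have hQdet : Q.det ≠ 0 := by
    rw [det_fin_two, hQ0, hQ0, hQ1, hQ1]
    rw [det₂] at hBv
    intro H
    exact hBv (by linear_combination H)
  obtain ⟨p, d, hpd⟩ : ∃ p d : F, A *ᵥ (B *ᵥ v) = p • v + d • (B *ᵥ v) :=
    ⟨_, _, eq_combination_of_det₂_ne_zero hBv _⟩
  have hAQ : A * Q = Q * !![c, p; 0, d] := by
    ext i j
    fin_cases j
    · have := congrFun hAv i
      simp only [mulVec, dotProduct, Fin.sum_univ_two, Pi.smul_apply, smul_eq_mul] at this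
      simp [Matrix.mul_apply, Fin.sum_univ_two, hQ0]
      linear_combination this
    · have := congrFun hpd i
      rw [mulVec, dotProduct, Fin.sum_univ_two] at this
      simp only [Pi.add_apply, Pi.smul_apply, smul_eq_mul] at this
      simp only [Matrix.mul_apply, Fin.sum_univ_two, hQ0, hQ1, Fin.mk_one, of_apply, cons_val_one,
        cons_val_zero, cons_val', cons_val_fin_one]
      linear_combination this
  have hBQ : B * Q = Q * !![0, -1; 1, α] := by
    have hBB : B *ᵥ (B *ᵥ v) = α • (B *ᵥ v) - v := by
      rw [mulVec_mulVec, mul_self_eq hB tB, sub_mulVec, smul_mulVec, one_mulVec]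
    ext i j
    fin_cases j
    · simp [Matrix.mul_apply, Fin.sum_univ_two, hQ0, hQ1, mulVec, dotProduct]
    · have := congrFun hBB i
      rw [mulVec, dotProduct, Fin.sum_univ_two] at this
      simp only [Pi.sub_apply, Pi.smul_apply, smul_eq_mul] at this
      simp only [Matrix.mul_apply, Fin.sum_univ_two, hQ0, hQ1, Fin.mk_one, of_apply, cons_val_one,
        cons_val_zero, cons_val', cons_val_fin_one]
      linear_combination this
  have hQu : IsUnit Q.det := isUnit_iff_ne_zero.mpr hQdet
  have trQ : ∀ D E : Matrix (Fin 2) (Fin 2) F, D * Q = Q * E → D.trace = E.trace := by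
    intro D E hDE
    have h1 : D = Q * E * Q⁻¹ := by
      rw [← hDE, mul_assoc, mul_nonsing_inv _ hQu, mul_one]
    rw [h1, trace_mul_comm, ← mul_assoc, nonsing_inv_mul _ hQu, one_mul]
  -- In the basis v, B v the only unknowns are d and p; tr A fixes d and tr AB fixes p.
  have hd : d = α - c := by
    have h1 := trQ _ _ hAQ
    rw [tA, trace_fin_two] at h1
    simp only [of_apply, cons_val_zero, cons_val_one, cons_val', cons_val_fin_one] at h1
    linear_combination -h1
  have hp : p = β - (α - c) * α := by
    have h1 := trQ (A * B) (!![c, p; 0, d] * !![0, -1; 1, α])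
      (by rw [mul_assoc, hBQ, ← mul_assoc, hAQ, mul_assoc])
    rw [tAB, trace_fin_two] at h1
    simp [Matrix.mul_apply, Fin.sum_univ_two] at h1
    rw [← hd]
    linear_combination -h1
  exact ⟨Q, hQdet, by rw [hAQ, hd, hp], hBQ⟩

/-- Both pairs have the same normal form once the same root c of the characteristic polynomial is
used for both. -/
theorem exists_intertwiner_of_isAlgClosed [IsAlgClosed F] {A B A' B' : Matrix (Fin 2) (Fin 2) F}
    {α β : F} (hA : A.det = 1) (hB : B.det = 1) (tA : A.trace = α) (tB : B.trace = α)
    (tAB : (A * B).trace = β) (h : (A * B - B * A).det ≠ 0)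
    (hA' : A'.det = 1) (hB' : B'.det = 1) (tA' : A'.trace = α) (tB' : B'.trace = α)
    (tAB' : (A' * B').trace = β) (h' : (A' * B' - B' * A').det ≠ 0) :
    ∃ P : Matrix (Fin 2) (Fin 2) F, P ≠ 0 ∧ P * A = A' * P ∧ P * B = B' * P := by
  obtain ⟨c, hc⟩ : ∃ c : F, c ^ 2 - α * c + 1 = 0 := by
    obtain ⟨c, v, hv, hc⟩ := exists_eigenvector A
    refine ⟨c, ?_⟩
    have hdet : (A - c • 1).det = 0 := Matrix.exists_mulVec_eq_zero_iff.mp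
      ⟨v, hv, by rw [sub_mulVec, hc, smul_mulVec, one_mulVec, sub_self]⟩
    rw [det_fin_two] at hA hdet
    rw [trace_fin_two] at tA
    simp only [Matrix.sub_apply, Matrix.smul_apply, smul_eq_mul, one_apply_eq, ne_eq, zero_ne_one, one_ne_zero,
      not_false_eq_true, one_apply_ne] at hdet
    linear_combination hdet - hA + c * tA
  obtain ⟨Q, hQ, hAQ, hBQ⟩ := exists_normalForm hA hB tA tB tAB h hc
  obtain ⟨Q', hQ', hAQ', hBQ'⟩ := exists_normalForm hA' hB' tA' tB' tAB' h' hc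
  have hQu : IsUnit Q.det := isUnit_iff_ne_zero.mpr hQ
  have key : ∀ D E D' : Matrix (Fin 2) (Fin 2) F, D * Q = Q * E → D' * Q' = Q' * E →
      Q' * Q⁻¹ * D = D' * (Q' * Q⁻¹) := by
    intro D E D' h1 h2
    have h3 : Q⁻¹ * D = E * Q⁻¹ := by
      calc Q⁻¹ * D = Q⁻¹ * (D * Q) * Q⁻¹ := by
            rw [mul_assoc, mul_assoc, mul_nonsing_inv _ hQu, mul_one]
        _ = E * Q⁻¹ := by rw [h1, ← mul_assoc, nonsing_inv_mul _ hQu, one_mul]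
    rw [mul_assoc, h3, ← mul_assoc, ← h2, mul_assoc]
  refine ⟨Q' * Q⁻¹, ?_, key _ _ _ hAQ hAQ', key _ _ _ hBQ hBQ'⟩
  intro H
  have : Q' = 0 := by
    calc Q' = Q' * Q⁻¹ * Q := by rw [mul_assoc, nonsing_inv_mul _ hQu, mul_one]
      _ = 0 := by rw [H, zero_mul]
  rw [this] at hQ'
  simp at hQ'

/-- The intertwining equations are linear over F, so an F-linear functional applied to the entries
of a solution over the algebraic closure gives a solution over F, nonzero for a suitable functional.
It is invertible since its kernel is stable under A and B, which have no common eigenvector. -/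
theorem exists_intertwiner {A B A' B' : Matrix (Fin 2) (Fin 2) F}
    {α β : F} (hA : A.det = 1) (hB : B.det = 1) (tA : A.trace = α) (tB : B.trace = α)
    (tAB : (A * B).trace = β) (h : (A * B - B * A).det ≠ 0)
    (hA' : A'.det = 1) (hB' : B'.det = 1) (tA' : A'.trace = α) (tB' : B'.trace = α)
    (tAB' : (A' * B').trace = β) (h' : (A' * B' - B' * A').det ≠ 0) :
    ∃ P : Matrix (Fin 2) (Fin 2) F, P.det ≠ 0 ∧ P * A = A' * P ∧ P * B = B' * P := by
  let K := AlgebraicClosure F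
  let φ : Matrix (Fin 2) (Fin 2) F →+* Matrix (Fin 2) (Fin 2) K := (algebraMap F K).mapMatrix
  have hφd : ∀ D, (φ D).det = algebraMap F K D.det := fun D => ((algebraMap F K).map_det D).symm
  have hφt : ∀ D, (φ D).trace = algebraMap F K D.trace := fun D =>
    (AddMonoidHom.map_trace (algebraMap F K) D).symm
  have hφc : ∀ C D : Matrix (Fin 2) (Fin 2) F, (C * D - D * C).det ≠ 0 →
      (φ C * φ D - φ D * φ C).det ≠ 0 := by
    intro C D hCD
    rw [← map_mul, ← map_mul, ← map_sub, hφd]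
    simpa using hCD
  obtain ⟨P, hP, hPA, hPB⟩ := exists_intertwiner_of_isAlgClosed
    (A := φ A) (B := φ B) (A' := φ A') (B' := φ B')
    (α := algebraMap F K α) (β := algebraMap F K β)
    (by rw [hφd, hA, map_one]) (by rw [hφd, hB, map_one]) (by rw [hφt, tA]) (by rw [hφt, tB])
    (by rw [← map_mul, hφt, tAB]) (hφc _ _ h)
    (by rw [hφd, hA', map_one]) (by rw [hφd, hB', map_one]) (by rw [hφt, tA']) (by rw [hφt, tB'])
    (by rw [← map_mul, hφt, tAB']) (hφc _ _ h')
  obtain ⟨i, j, hij⟩ : ∃ i j, P i j ≠ 0 := by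
    by_contra! H
    exact hP (Matrix.ext H)
  obtain ⟨l, hl⟩ : ∃ l : K →ₗ[F] F, l (P i j) ≠ 0 := by
    by_contra! H
    exact hij ((Module.forall_dual_apply_eq_zero_iff F (P i j)).mp H)
  have descend : ∀ C C' : Matrix (Fin 2) (Fin 2) F, P * φ C = φ C' * P →
      P.map l * C = C' * P.map l := by
    intro C C' hC
    ext r s
    have h1 := congrArg l (congrFun (congrFun hC r) s)
    simp only [Matrix.mul_apply, Fin.sum_univ_two, map_add] at h1 ⊢
    have e1 : ∀ (p : K) (q : F), l (p * algebraMap F K q) = l p * q := by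
      intro p q
      rw [mul_comm, ← Algebra.smul_def, map_smul, smul_eq_mul, mul_comm]
    have e2 : ∀ (p : K) (q : F), l (algebraMap F K q * p) = q * l p := by
      intro p q
      rw [← Algebra.smul_def, map_smul, smul_eq_mul]
    have e3 : ∀ D r s, φ D r s = algebraMap F K (D r s) := fun _ _ _ => rfl
    simpa only [e3, e1, e2, Matrix.map_apply] using h1
  refine ⟨P.map l, ?_, descend _ _ hPA, descend _ _ hPB⟩
  have hPA' := descend _ _ hPA
  have hPB' := descend _ _ hPB
  intro hdet
  obtain ⟨v, hv, hPv⟩ := Matrix.exists_mulVec_eq_zero_iff.mpr hdet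
  have hmem : ∀ C C' : Matrix (Fin 2) (Fin 2) F, P.map l * C = C' * P.map l →
      P.map l *ᵥ (C *ᵥ v) = 0 := by
    intro C C' hC
    rw [mulVec_mulVec, hC, ← mulVec_mulVec, hPv, mulVec_zero]
  have hzero : ∀ u, P.map l *ᵥ u = 0 → det₂ v u ≠ 0 → False := by
    intro u hu hvu
    refine hl ?_
    have h1 := mem_of_det₂_ne_zero (W := LinearMap.ker (Matrix.mulVecLin (P.map l)))
      hPv hu hvu (Pi.single j 1)
    have h2 : P.map l *ᵥ (Pi.single j 1) = 0 := h1
    have h3 := congrFun h2 i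
    simpa using h3
  rcases det₂_mulVec_ne_zero h hv with h1 | h1
  · exact hzero _ (hmem _ _ hPA') h1
  · exact hzero _ (hmem _ _ hPB') h1

end Conjugation

/-! ### Pairs of matrices with prescribed traces over a finite field -/

/-- As a quadratic in r the equation has the discriminant displayed below, so it suffices to make
this a square t². For α² ≠ 4 that is a sum of two one-variable quadratics, which has a zero over a
finite field of odd order; for α² = 4, t = s = 0 works. -/
theorem exists_conic_point {F : Type*} [Field F] [Finite F] (h2 : (2 : F) ≠ 0) (α : F) : ∃ r s : F, s ^ 2 + r ^ 2 - α * r * s + α * r - α * s + 1 = 0 := by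
  obtain ⟨t, s, hts⟩ : ∃ t s : F,
      t ^ 2 = (α ^ 2 - 4) * s ^ 2 + (4 * α - 2 * α ^ 2) * s + (α ^ 2 - 4) := by
    by_cases h4 : α ^ 2 - 4 = 0
    · refine ⟨0, 0, ?_⟩
      rw [h4]
      ring
    · have := Fintype.ofFinite F
      have hchar : ringChar F ≠ 2 := fun h => h2 (by
        have := CharP.cast_eq_zero F (ringChar F)
        rw [h] at this
        exact_mod_cast this)
      obtain ⟨t, s, h⟩ := FiniteField.exists_root_sum_quadratic (R := F) (f := X ^ 2)
        (g := C (-(α ^ 2 - 4)) * X ^ 2 + C (-(4 * α - 2 * α ^ 2)) * X + C (-(α ^ 2 - 4)))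
        (degree_X_pow 2) (degree_quadratic (neg_ne_zero.mpr h4))
        (FiniteField.odd_card_of_char_ne_two hchar)
      refine ⟨t, s, ?_⟩
      simp only [eval_add, eval_mul, eval_pow, eval_X, eval_C] at h
      linear_combination h
  refine ⟨(α * s - α + t) / 2, s, ?_⟩
  field_simp
  linear_combination hts

/-- With A a companion matrix, the trace conditions on B are linear and leave r and s free; det B =
1 is then the conic. -/
theorem exists_pair_of_traces {F : Type*} [Field F] [Finite F] (h2 : (2 : F) ≠ 0) (α : F) : ∃ A B : SpecialLinearGroup (Fin 2) F,
    (A : Matrix (Fin 2) (Fin 2) F).trace = α ∧ (B : Matrix (Fin 2) (Fin 2) F).trace = α ∧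
    ((A : Matrix (Fin 2) (Fin 2) F) * (B : Matrix (Fin 2) (Fin 2) F)).trace = α := by
  obtain ⟨r, s, h⟩ := exists_conic_point h2 α
  refine ⟨⟨!![0, -1; 1, α], by simp [det_fin_two]⟩,
    ⟨!![α - s, r + α - α * s; r, s], ?_⟩, ?_, ?_, ?_⟩
  · simp only [det_fin_two, of_apply, cons_val_zero, cons_val_one, cons_val', cons_val_fin_one]
    linear_combination -h
  · simp [trace_fin_two]
  · simp [trace_fin_two]
  · simp [trace_fin_two]

end TwistKnot

namespace TwistKnot

/-! ### Homomorphisms from the knot group -/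

/-- The element `w = a b⁻¹ a⁻¹ b` of `π n`. -/
def genW (n : ℤ) : KnotGroup n := genA n * (genB n)⁻¹ * (genA n)⁻¹ * genB n

theorem genA_mul_zpow (n : ℤ) : genA n * genW n ^ n = genW n ^ n * genB n := by
  have h := PresentedGroup.mk_eq_mk_of_mul_inv_mem
    (rels := {(FreeGroup.of 0 * word ^ n) * (word ^ n * FreeGroup.of 1)⁻¹})
    (Set.mem_singleton ((FreeGroup.of 0 * word ^ n) * (word ^ n * FreeGroup.of 1)⁻¹))
  exact h

theorem closure_genA_genB (n : ℤ) : Subgroup.closure {genA n, genB n} = ⊤ := by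
  rw [eq_top_iff]
  intro g _
  refine PresentedGroup.generated_by _ _ (fun j => ?_) g
  fin_cases j
  · exact Subgroup.subset_closure (Or.inl rfl)
  · exact Subgroup.subset_closure (Or.inr rfl)

/-- The homomorphism from `π n` with given values on the generators. -/
def knotHom {n : ℤ} {H : Type*} [Group H] (A B : H)
    (h : A * (A * B⁻¹ * A⁻¹ * B) ^ n = (A * B⁻¹ * A⁻¹ * B) ^ n * B) : KnotGroup n →* H :=
  PresentedGroup.toGroup (f := ![A, B]) (by
    intro r hr
    rw [Set.mem_singleton_iff] at hr
    rw [hr, map_mul, map_inv, mul_inv_eq_one]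
    simpa [word] using h)

theorem knotHom_genA {n : ℤ} {H : Type*} [Group H] {A B : H}
    (h : A * (A * B⁻¹ * A⁻¹ * B) ^ n = (A * B⁻¹ * A⁻¹ * B) ^ n * B) :
    knotHom A B h (genA n) = A := PresentedGroup.toGroup.of _

theorem knotHom_genB {n : ℤ} {H : Type*} [Group H] {A B : H}
    (h : A * (A * B⁻¹ * A⁻¹ * B) ^ n = (A * B⁻¹ * A⁻¹ * B) ^ n * B) :
    knotHom A B h (genB n) = B := PresentedGroup.toGroup.of _

theorem knotGroup_induction {n : ℤ} {P : KnotGroup n → Prop} (hA : P (genA n)) (hB : P (genB n))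
    (one : P 1) (mul : ∀ g h, P g → P h → P (g * h)) (inv : ∀ g, P g → P g⁻¹)
    (g : KnotGroup n) : P g := by
  have hg : g ∈ Subgroup.closure {genA n, genB n} := closure_genA_genB n ▸ Subgroup.mem_top g
  induction hg using Subgroup.closure_induction with
  | mem g hg => rcases hg with rfl | rfl <;> assumption
  | one => exact one
  | mul g h _ _ ih ih' => exact mul g h ih ih'
  | inv g _ ih => exact inv g ih

/-! ### Geometric sums and affine permutations -/

section Affine

variable {S M : Type*} [Ring S] [AddCommGroup M] [Module S M]

/-- The sum `1 + u + ⋯ + uⁿ⁻¹`, with the usual convention for negative `n`. -/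
def zgeomSum (u : Sˣ) : ℤ → S
  | Int.ofNat m => ∑ i ∈ Finset.range m, ((u ^ i : Sˣ) : S)
  | Int.negSucc m => -∑ i ∈ Finset.range (m + 1), ((u ^ (-(i + 1) : ℤ) : Sˣ) : S)

theorem zgeomSum_zero (u : Sˣ) : zgeomSum u 0 = 0 := by
  change ∑ i ∈ Finset.range 0, ((u ^ i : Sˣ) : S) = 0
  simp

theorem zgeomSum_add_one (u : Sˣ) (n : ℤ) :
    zgeomSum u (n + 1) = zgeomSum u n + ((u ^ n : Sˣ) : S) := by
  obtain m | m := n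
  · change ∑ i ∈ Finset.range (m + 1), ((u ^ i : Sˣ) : S) =
      ∑ i ∈ Finset.range m, ((u ^ i : Sˣ) : S) + _
    rw [Finset.sum_range_succ]
    simp
  · cases m with
    | zero =>
      change ∑ i ∈ Finset.range 0, ((u ^ i : Sˣ) : S) =
        -∑ i ∈ Finset.range 1, ((u ^ (-(i + 1) : ℤ) : Sˣ) : S) + _
      simp
    | succ m =>
      have h : Int.negSucc (m + 1) + 1 = Int.negSucc m := rfl
      rw [h]
      change -∑ i ∈ Finset.range (m + 1), ((u ^ (-(i + 1) : ℤ) : Sˣ) : S) =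
        -∑ i ∈ Finset.range (m + 1 + 1), ((u ^ (-(i + 1) : ℤ) : Sˣ) : S) + _
      rw [Finset.sum_range_succ _ (m + 1)]
      have h2 : Int.negSucc (m + 1) = -((m + 1 : ℕ) + 1) := rfl
      rw [h2]
      abel

theorem zgeomSum_induction {P : ℤ → S → Prop} (u : Sˣ) (zero : P 0 0)
    (succ : ∀ n s, P n s → P (n + 1) (s + ((u ^ n : Sˣ) : S)))
    (pred : ∀ n s, P (n + 1) (s + ((u ^ n : Sˣ) : S)) → P n s) (n : ℤ) : P n (zgeomSum u n) := by
  induction n using Int.induction_on with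
  | zero => rwa [zgeomSum_zero]
  | succ i ih =>
    rw [zgeomSum_add_one]
    exact succ _ _ ih
  | pred i ih =>
    refine pred _ _ ?_
    rwa [← zgeomSum_add_one, sub_add_cancel]

theorem zgeomSum_mul_sub_one (u : Sˣ) (n : ℤ) :
    zgeomSum u n * ((u : S) - 1) = ((u ^ n : Sˣ) : S) - 1 := by
  have key : ∀ m : ℤ, ((u ^ (m + 1) : Sˣ) : S) = ((u ^ m : Sˣ) : S) * u := by
    intro m
    rw [zpow_add_one, Units.val_mul]
  refine zgeomSum_induction (P := fun n s => s * ((u : S) - 1) = ((u ^ n : Sˣ) : S) - 1) u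
    ?_ (fun m s h => ?_) (fun m s h => ?_) n
  · simp
  · rw [add_mul, h, key]
    noncomm_ring
  · rw [add_mul, key] at h
    have : s * ((u : S) - 1) = ((u ^ m : Sˣ) : S) * u - 1 - ((u ^ m : Sˣ) : S) * ((u : S) - 1) :=
      eq_sub_of_add_eq h
    rw [this]
    noncomm_ring

theorem zgeomSum_one (n : ℤ) : zgeomSum (1 : Sˣ) n = n := by
  refine zgeomSum_induction (P := fun n s => s = (n : S)) 1 ?_ (fun m s h => ?_)
    (fun m s h => ?_) n
  · simp
  · simp [h]
  · simpa using h

/-- The permutation `v ↦ u • v + m`. -/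
def affinePerm (u : Sˣ) (m : M) : Equiv.Perm M where
  toFun v := u • v + m
  invFun v := u⁻¹ • (v - m)
  left_inv v := by simp
  right_inv v := by simp

theorem affinePerm_apply (u : Sˣ) (m v : M) : affinePerm u m v = u • v + m := rfl

/-- The translation part multiplies by the product rule of a derivation, so homomorphisms into
affine permutations encode derivations. -/
theorem affinePerm_mul (u u' : Sˣ) (m m' : M) :
    affinePerm u m * affinePerm u' m' = affinePerm (u * u') (u • m' + m) := by
  ext v
  simp only [Equiv.Perm.mul_apply, affinePerm_apply, smul_add, mul_smul, add_assoc]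

theorem affinePerm_one : affinePerm (1 : Sˣ) (0 : M) = 1 := by
  ext v
  simp [affinePerm_apply]

theorem affinePerm_inv (u : Sˣ) (m : M) :
    (affinePerm u m)⁻¹ = affinePerm u⁻¹ (-(u⁻¹ • m)) := by
  rw [inv_eq_iff_mul_eq_one, affinePerm_mul, mul_inv_cancel, smul_neg, smul_inv_smul,
    neg_add_cancel, affinePerm_one]

theorem affinePerm_zpow (u : Sˣ) (m : M) (n : ℤ) :
    affinePerm u m ^ n = affinePerm (u ^ n) (zgeomSum u n • m) := by
  refine zgeomSum_induction (P := fun n s => affinePerm u m ^ n = affinePerm (u ^ n) (s • m)) u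
    ?_ (fun k s h => ?_) (fun k s h => ?_) n
  · rw [zero_smul, zpow_zero, zpow_zero, affinePerm_one]
  · rw [zpow_add_one, zpow_add_one, h, affinePerm_mul, add_smul, add_comm]
    rfl
  · rw [zpow_add_one, ← eq_mul_inv_iff_mul_eq] at h
    rw [h, affinePerm_inv, affinePerm_mul, zpow_add_one, mul_inv_cancel_right, smul_neg,
      smul_smul, mul_inv_cancel_right, add_smul]
    congr 1
    change -(((u ^ k : Sˣ) : S) • m) + _ = _
    abel

theorem affinePerm_commutator (u v : Sˣ) (m m' : M) :
    affinePerm u m * (affinePerm v m')⁻¹ * (affinePerm u m)⁻¹ * affinePerm v m' =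
      affinePerm (u * v⁻¹ * u⁻¹ * v)
        ((1 - ((u * v⁻¹ * u⁻¹ : Sˣ) : S)) • m +
          (((u * v⁻¹ * u⁻¹ : Sˣ) : S) - ((u * v⁻¹ : Sˣ) : S)) • m') := by
  rw [affinePerm_inv, affinePerm_inv, affinePerm_mul, affinePerm_mul, affinePerm_mul]
  congr 1
  simp only [Units.smul_def, Units.val_mul, smul_neg, sub_smul, one_smul, mul_smul]
  abel

end Affine

/-! ### The element `w` has infinite order -/

/-- In the affine group of ℂ, send a to v ↦ t v and b to v ↦ t v + 1. Then w is the translation by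
t⁻¹ - 1, and the relation holds exactly when t is a root of the Alexander polynomial n (t - 1)² + t.
As t ≠ 1 and the characteristic is 0, this translation has infinite order. -/
theorem genW_zpow_ne_one {n : ℤ} (hn : n ≠ 0) {m : ℤ} (hm : m ≠ 0) : genW n ^ m ≠ 1 := by
  obtain ⟨t, ht⟩ : ∃ t : ℂ, (n : ℂ) * (t - 1) ^ 2 + t = 0 := by
    have hn' : (n : ℂ) ≠ 0 := by exact_mod_cast hn
    obtain ⟨t, ht⟩ := IsAlgClosed.exists_root
      (C (n : ℂ) * X ^ 2 + C (1 - 2 * (n : ℂ)) * X + C (n : ℂ))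
      (by rw [degree_quadratic hn']; norm_num)
    refine ⟨t, ?_⟩
    simp only [IsRoot, eval_add, eval_mul, eval_C, eval_pow, eval_X] at ht
    linear_combination ht
  have ht0 : t ≠ 0 := by
    rintro rfl
    simp at ht
    exact hn ht
  have ht1 : t ≠ 1 := by
    rintro rfl
    simp at ht
  let u : ℂˣ := Units.mk0 t ht0
  have huv : ((u⁻¹ : ℂˣ) : ℂ) = t⁻¹ := rfl
  have hu : (u : ℂ) = t := rfl
  have hw : affinePerm u (0 : ℂ) * (affinePerm u (1 : ℂ))⁻¹ * (affinePerm u (0 : ℂ))⁻¹ *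
      affinePerm u (1 : ℂ) = affinePerm (1 : ℂˣ) (t⁻¹ - 1) := by
    rw [affinePerm_commutator]
    congr 1
    · simp
    · simp [huv]
  have hwn : ∀ k : ℤ, (affinePerm u (0 : ℂ) * (affinePerm u (1 : ℂ))⁻¹ *
      (affinePerm u (0 : ℂ))⁻¹ * affinePerm u (1 : ℂ)) ^ k =
      affinePerm (1 : ℂˣ) (k * (t⁻¹ - 1)) := by
    intro k
    rw [hw, affinePerm_zpow, zgeomSum_one, one_zpow, smul_eq_mul]
  have hrel : affinePerm u (0 : ℂ) * (affinePerm u (0 : ℂ) * (affinePerm u (1 : ℂ))⁻¹ *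
      (affinePerm u (0 : ℂ))⁻¹ * affinePerm u (1 : ℂ)) ^ n =
      (affinePerm u (0 : ℂ) * (affinePerm u (1 : ℂ))⁻¹ *
      (affinePerm u (0 : ℂ))⁻¹ * affinePerm u (1 : ℂ)) ^ n * affinePerm u (1 : ℂ) := by
    rw [hwn, affinePerm_mul, affinePerm_mul, mul_one, one_mul]
    congr 1
    simp only [Units.smul_def, hu, Units.val_one, smul_eq_mul]
    field_simp
    linear_combination -ht
  intro h
  have h1 := congrArg (knotHom (affinePerm u (0 : ℂ)) (affinePerm u (1 : ℂ)) hrel) h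
  rw [map_zpow, genW, map_mul, map_mul, map_mul, map_inv, map_inv, knotHom_genA, knotHom_genB,
    map_one, hwn] at h1
  have h2 := Equiv.congr_fun h1 0
  simp only [affinePerm_apply, smul_zero, zero_add, Equiv.Perm.one_apply, mul_eq_zero] at h2
  rcases h2 with h2 | h2
  · exact hm (by exact_mod_cast h2)
  · rw [sub_eq_zero, inv_eq_one] at h2
    exact ht1 h2

end TwistKnot

namespace TwistKnot

/-! ### Fox calculus over the group algebra -/

section Fox

variable (F : Type*) [Field F] (n : ℤ)

/-- The group algebra of `π n`. -/
abbrev KnotAlgebra : Type _ := MonoidAlgebra F (KnotGroup n)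

/-- The elements of `π n` as units of the group algebra. -/
noncomputable def groupUnit : KnotGroup n →* (KnotAlgebra F n)ˣ :=
  (MonoidAlgebra.of F (KnotGroup n)).toHomUnits

/-- The element `1 + w + ⋯ + wⁿ⁻¹` of the group algebra. -/
noncomputable def foxW : KnotAlgebra F n := zgeomSum (groupUnit F n (genW n)) n

/-- The Fox derivative of the relation with respect to `a`. -/
noncomputable def foxA : KnotAlgebra F n :=
  1 + (MonoidAlgebra.of F _ (genA n) - 1) * foxW F n *
    (1 - MonoidAlgebra.of F _ (genA n * (genB n)⁻¹ * (genA n)⁻¹))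

/-- The Fox derivative of the relation with respect to `b`. -/
noncomputable def foxB : KnotAlgebra F n :=
  (MonoidAlgebra.of F _ (genA n) - 1) * foxW F n *
    (MonoidAlgebra.of F _ (genA n * (genB n)⁻¹ * (genA n)⁻¹) -
      MonoidAlgebra.of F _ (genA n * (genB n)⁻¹)) - MonoidAlgebra.of F _ (genW n ^ n)

variable {F n}

theorem coe_groupUnit (g : KnotGroup n) :
    (groupUnit F n g : KnotAlgebra F n) = MonoidAlgebra.of F _ g := rfl

theorem foxW_mul : foxW F n * (MonoidAlgebra.of F _ (genW n) - 1) =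
    MonoidAlgebra.of F _ (genW n ^ n) - 1 := by
  have h := zgeomSum_mul_sub_one (groupUnit F n (genW n)) n
  rw [← map_zpow, coe_groupUnit, coe_groupUnit] at h
  exact h

/-- Fox's fundamental formula: the left side equals a wⁿ - wⁿ b, which vanishes in the group
algebra. -/
theorem foxA_mul_add_foxB_mul : foxA F n * (MonoidAlgebra.of F _ (genA n) - 1) +
    foxB F n * (MonoidAlgebra.of F _ (genB n) - 1) = 0 := by
  have h1 : (1 - MonoidAlgebra.of F _ (genA n * (genB n)⁻¹ * (genA n)⁻¹)) *
      (MonoidAlgebra.of F _ (genA n) - 1) +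
      (MonoidAlgebra.of F _ (genA n * (genB n)⁻¹ * (genA n)⁻¹) -
        MonoidAlgebra.of F _ (genA n * (genB n)⁻¹)) * (MonoidAlgebra.of F _ (genB n) - 1) =
      MonoidAlgebra.of F _ (genW n) - 1 := by
    simp only [mul_sub, sub_mul, one_mul, mul_one, ← map_mul, inv_mul_cancel_right, genW]
    abel
  have h2 : MonoidAlgebra.of F _ (genA n) * MonoidAlgebra.of F _ (genW n ^ n) =
      MonoidAlgebra.of F _ (genW n ^ n) * MonoidAlgebra.of F _ (genB n) := by
    rw [← map_mul, genA_mul_zpow, map_mul]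
  calc _ = (MonoidAlgebra.of F _ (genA n) - 1) + (MonoidAlgebra.of F _ (genA n) - 1) *
        (foxW F n * ((1 - MonoidAlgebra.of F _ (genA n * (genB n)⁻¹ * (genA n)⁻¹)) *
      (MonoidAlgebra.of F _ (genA n) - 1) +
      (MonoidAlgebra.of F _ (genA n * (genB n)⁻¹ * (genA n)⁻¹) -
        MonoidAlgebra.of F _ (genA n * (genB n)⁻¹)) * (MonoidAlgebra.of F _ (genB n) - 1))) -
        MonoidAlgebra.of F _ (genW n ^ n) * (MonoidAlgebra.of F _ (genB n) - 1) := by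
        rw [foxA, foxB]
        noncomm_ring
    _ = MonoidAlgebra.of F _ (genA n) * MonoidAlgebra.of F _ (genW n ^ n) -
      MonoidAlgebra.of F _ (genW n ^ n) * MonoidAlgebra.of F _ (genB n) := by
        rw [h1, foxW_mul]
        noncomm_ring
    _ = 0 := by rw [h2, sub_self]

/-- A derivation on `π n` with prescribed values on the generators. -/
theorem exists_derivation {M : Type*} [AddCommGroup M] [Module (KnotAlgebra F n) M] (e₁ e₂ : M)
    (h : foxA F n • e₁ + foxB F n • e₂ = 0) : ∃ D : KnotGroup n → M,
    (∀ g g', D (g * g') = D g + MonoidAlgebra.of F _ g • D g') ∧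
      D (genA n) = e₁ ∧ D (genB n) = e₂ := by
  set a := groupUnit F n (genA n) with ha
  set b := groupUnit F n (genB n) with hb
  have hab : a * b⁻¹ * a⁻¹ * b = groupUnit F n (genW n) := by
    rw [genW, map_mul, map_mul, map_mul, map_inv, map_inv]
  -- The linear parts agree by the relation of the group; the difference of the translation parts is
  -- the left side of `h`.
  have hrel : affinePerm a e₁ * (affinePerm a e₁ * (affinePerm b e₂)⁻¹ * (affinePerm a e₁)⁻¹ *
      affinePerm b e₂) ^ n = (affinePerm a e₁ * (affinePerm b e₂)⁻¹ * (affinePerm a e₁)⁻¹ *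
      affinePerm b e₂) ^ n * affinePerm b e₂ := by
    rw [affinePerm_commutator, affinePerm_zpow, affinePerm_mul, affinePerm_mul, hab, ← map_zpow,
      ha, hb, ← map_mul, ← map_mul, genA_mul_zpow]
    congr 1
    rw [← sub_eq_zero, ← h, foxA, foxB, foxW]
    simp only [← map_inv, ← map_mul, coe_groupUnit, Units.smul_def]
    generalize zgeomSum (groupUnit F n (genW n)) n = W
    simp only [smul_add, sub_smul, add_smul, one_smul, mul_smul, smul_sub]
    abel
  have aff : ∀ g, ∃ m, knotHom _ _ hrel g = affinePerm (groupUnit F n g) m := by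
    intro g
    induction g using knotGroup_induction with
    | hA => exact ⟨e₁, knotHom_genA _⟩
    | hB => exact ⟨e₂, knotHom_genB _⟩
    | one => exact ⟨0, by rw [map_one, map_one, affinePerm_one]⟩
    | mul g g' ih ih' =>
      obtain ⟨m, hm⟩ := ih
      obtain ⟨m', hm'⟩ := ih'
      exact ⟨_, by rw [map_mul, hm, hm', affinePerm_mul, map_mul]⟩
    | inv g ih =>
      obtain ⟨m, hm⟩ := ih
      exact ⟨_, by rw [map_inv, hm, affinePerm_inv, map_inv]⟩
  choose D hD using aff
  have hD0 : ∀ g, D g = knotHom _ _ hrel g 0 := by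
    intro g
    rw [hD, affinePerm_apply, smul_zero, zero_add]
  refine ⟨D, fun g g' => ?_, ?_, ?_⟩
  · rw [hD0, map_mul, hD, hD g', affinePerm_mul, affinePerm_apply, smul_zero, zero_add, add_comm]
    rfl
  · rw [hD0, knotHom_genA, affinePerm_apply, smul_zero, zero_add]
  · rw [hD0, knotHom_genB, affinePerm_apply, smul_zero, zero_add]

/-- Exactness of the Fox complex in degree one. -/
theorem exists_mul_fox {u v : KnotAlgebra F n}
    (h : u * (MonoidAlgebra.of F _ (genA n) - 1) + v * (MonoidAlgebra.of F _ (genB n) - 1) = 0) :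
    ∃ c, u = c * foxA F n ∧ v = c * foxB F n := by
  let N : Submodule (KnotAlgebra F n) (KnotAlgebra F n × KnotAlgebra F n) :=
    Submodule.span _ {(foxA F n, foxB F n)}
  -- The target is the cokernel of the degree-two differential. The linear extension L of D
  -- satisfies L (x (g - 1)) = x D(g), so applying L to `h` shows that (u, v) vanishes in the
  -- cokernel.
  obtain ⟨D, hD, hDA, hDB⟩ := exists_derivation (N.mkQ (1, 0)) (N.mkQ (0, 1)) (by
    rw [← map_smul, ← map_smul, ← map_add, Submodule.mkQ_apply, Submodule.Quotient.mk_eq_zero]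
    refine Submodule.mem_span_singleton.mpr ⟨1, ?_⟩
    simp)
  let L : KnotAlgebra F n →ₗ[F] (KnotAlgebra F n × KnotAlgebra F n) ⧸ N :=
    Finsupp.linearCombination F D ∘ₗ (MonoidAlgebra.coeffLinearEquiv F).toLinearMap
  have hL : ∀ g r, L (MonoidAlgebra.single g r) = r • D g := by
    intro g r
    simp [L]
  have hLmul : ∀ (x : KnotAlgebra F n) (g : KnotGroup n),
      L (x * (MonoidAlgebra.of F _ g - 1)) = x • D g := by
    intro x g
    induction x using MonoidAlgebra.induction_linear with
    | zero => simp
    | add x y hx hy => rw [add_mul, map_add, hx, hy, add_smul]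
    | single g' r =>
      rw [mul_sub, mul_one, MonoidAlgebra.of_apply, MonoidAlgebra.single_mul_single, mul_one,
        map_sub, hL, hL, hD, smul_add, add_sub_cancel_left, ← smul_assoc, MonoidAlgebra.of_apply,
        MonoidAlgebra.smul_single, smul_eq_mul, mul_one]
  have h1 := congrArg L h
  rw [map_add, hLmul, hLmul, hDA, hDB, map_zero, ← map_smul, ← map_smul, ← map_add,
    Submodule.mkQ_apply, Submodule.Quotient.mk_eq_zero] at h1
  obtain ⟨c, hc⟩ := Submodule.mem_span_singleton.mp h1
  refine ⟨c, ?_, ?_⟩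
  · have := congrArg Prod.fst hc
    simpa using this.symm
  · have := congrArg Prod.snd hc
    simpa using this.symm

/-- Exactness of the Fox complex in degree zero. -/
theorem exists_eq_mul_sub_one (x : KnotAlgebra F n) : ∃ u v : KnotAlgebra F n,
    x = MonoidAlgebra.single 1 (x.coeff.sum fun _ r => r) +
      (u * (MonoidAlgebra.of F _ (genA n) - 1) + v * (MonoidAlgebra.of F _ (genB n) - 1)) := by
  let I : Submodule (KnotAlgebra F n) (KnotAlgebra F n) := Submodule.span _
    {MonoidAlgebra.of F _ (genA n) - 1, MonoidAlgebra.of F _ (genB n) - 1}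
  have hI : ∀ g : KnotGroup n, MonoidAlgebra.of F _ g - 1 ∈ I := by
    intro g
    induction g using knotGroup_induction with
    | hA => exact Submodule.subset_span (Or.inl rfl)
    | hB => exact Submodule.subset_span (Or.inr rfl)
    | one => rw [map_one, sub_self]; exact I.zero_mem
    | mul g g' ih ih' =>
      have : MonoidAlgebra.of F _ (g * g') - 1 = MonoidAlgebra.of F _ g •
        (MonoidAlgebra.of F _ g' - 1) + (MonoidAlgebra.of F _ g - 1) := by
        rw [map_mul, smul_eq_mul]
        noncomm_ring
      rw [this]
      exact I.add_mem (I.smul_mem _ ih') ih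
    | inv g ih =>
      have : MonoidAlgebra.of F _ g⁻¹ - 1 = (-MonoidAlgebra.of F _ g⁻¹) •
        (MonoidAlgebra.of F _ g - 1) := by
        rw [smul_eq_mul, neg_mul, mul_sub, ← map_mul, inv_mul_cancel, map_one, mul_one, neg_sub]
      rw [this]
      exact I.smul_mem _ ih
  have key : x - MonoidAlgebra.single 1 (x.coeff.sum fun _ r => r) ∈ I := by
    induction x using MonoidAlgebra.induction_linear with
    | zero => simp
    | add x y hx hy =>
      rw [MonoidAlgebra.coeff_add, Finsupp.sum_add_index' (by simp) (by simp),
        MonoidAlgebra.single_add, add_sub_add_comm]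
      exact I.add_mem hx hy
    | single g r =>
      have : MonoidAlgebra.single g r - MonoidAlgebra.single 1 r =
          (MonoidAlgebra.single 1 r : KnotAlgebra F n) • (MonoidAlgebra.of F _ g - 1) := by
        rw [smul_eq_mul, mul_sub, mul_one, MonoidAlgebra.of_apply,
          MonoidAlgebra.single_mul_single, one_mul, mul_one]
      rw [MonoidAlgebra.coeff_single, Finsupp.sum_single_index rfl, this]
      exact I.smul_mem _ (hI g)
  obtain ⟨u, v, huv⟩ := Submodule.mem_span_pair.mp key
  refine ⟨u, v, ?_⟩
  rw [smul_eq_mul, smul_eq_mul] at huv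
  rw [huv]
  abel

/-! ### The Fox derivative with respect to `a` is not a zero divisor -/

/-- The coefficients are constant along the cosets of ⟨g⟩, which are infinite, while the support is
finite. -/
theorem eq_zero_of_mul_of_eq {G : Type*} [Group G] {g : G} (hg : ∀ m : ℤ, m ≠ 0 → g ^ m ≠ 1)
    {x : MonoidAlgebra F G} (h : x * MonoidAlgebra.of F G g = x) : x = 0 := by
  by_contra hx
  obtain ⟨γ, hγ⟩ : ∃ γ, x.coeff γ ≠ 0 := by
    by_contra! H
    exact hx (MonoidAlgebra.coeff_injective (Finsupp.ext H))
  have step : ∀ δ, x.coeff (δ * g⁻¹) = x.coeff δ := by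
    intro δ
    conv_rhs => rw [← h]
    rw [MonoidAlgebra.of_apply, MonoidAlgebra.coeff_mul_single_apply, mul_one]
  have hpow : ∀ k : ℕ, x.coeff (γ * (g⁻¹) ^ k) = x.coeff γ := by
    intro k
    induction k with
    | zero => simp
    | succ k ih => rw [pow_succ, ← mul_assoc, step, ih]
  have hinj : Function.Injective fun k : ℕ => γ * (g⁻¹) ^ k := by
    intro k l hkl
    by_contra hne
    have h1 : (g⁻¹) ^ k = (g⁻¹) ^ l := mul_left_cancel hkl
    refine hg ((k : ℤ) - l) (by omega) ?_
    rw [zpow_sub, mul_inv_eq_one, zpow_natCast, zpow_natCast]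
    rw [inv_pow, inv_pow, inv_inj] at h1
    exact h1
  refine Set.infinite_of_injective_forall_mem hinj (s := (x.coeff.support : Set G)) (fun k => ?_)
    x.coeff.support.finite_toSet
  rw [Finset.mem_coe, Finsupp.mem_support_iff, hpow]
  exact hγ

/-- The homomorphism `π n → ℤ` with `a, b ↦ 1`. -/
def degHom (n : ℤ) : KnotGroup n →* Multiplicative ℤ :=
  knotHom (Multiplicative.ofAdd 1) (Multiplicative.ofAdd 1) (mul_comm _ _)

/-- The degree of an element of `π n`. -/
def deg (g : KnotGroup n) : ℤ := (degHom n g).toAdd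

theorem deg_mul (g g' : KnotGroup n) : deg (g * g') = deg g + deg g' := by
  rw [deg, map_mul]; rfl

theorem deg_inv (g : KnotGroup n) : deg g⁻¹ = -deg g := by
  rw [deg, map_inv]; rfl

theorem deg_genA : deg (genA n) = 1 := by
  rw [deg, degHom, knotHom_genA]; rfl

theorem deg_genB : deg (genB n) = 1 := by
  rw [deg, degHom, knotHom_genB]; rfl

theorem deg_genW : deg (genW n) = 0 := by
  rw [genW, deg_mul, deg_mul, deg_mul, deg_inv, deg_inv, deg_genA, deg_genB]; rfl

theorem deg_zpow (g : KnotGroup n) (m : ℤ) : deg (g ^ m) = m * deg g := by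
  rw [deg, map_zpow, toAdd_zpow, smul_eq_mul]; rfl

/-- The homogeneous component of degree `d`. -/
noncomputable def proj (d : ℤ) : KnotAlgebra F n →+ KnotAlgebra F n where
  toFun x := .ofCoeff (x.coeff.filter fun g => deg g = d)
  map_zero' := by
    rw [MonoidAlgebra.coeff_zero, Finsupp.filter_zero, MonoidAlgebra.ofCoeff_zero]
  map_add' x y := by
    rw [MonoidAlgebra.coeff_add, Finsupp.filter_add, MonoidAlgebra.ofCoeff_add]

theorem coeff_proj (d : ℤ) (x : KnotAlgebra F n) (g : KnotGroup n) :
    (proj d x).coeff g = if deg g = d then x.coeff g else 0 :=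
  Finsupp.filter_apply _ _ _

/-- `s` is homogeneous of degree `e`, in terms of right multiplication by `s`. -/
def IsHomog (e : ℤ) (s : KnotAlgebra F n) : Prop :=
  ∀ (d : ℤ) (x : KnotAlgebra F n), proj (d + e) (x * s) = proj d x * s

theorem isHomog_of (g : KnotGroup n) : IsHomog (deg g) (MonoidAlgebra.of F _ g) := by
  intro d x
  apply MonoidAlgebra.coeff_injective
  ext γ
  rw [coeff_proj, MonoidAlgebra.of_apply, MonoidAlgebra.coeff_mul_single_apply,
    MonoidAlgebra.coeff_mul_single_apply, coeff_proj, deg_mul, deg_inv, mul_one, mul_one]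
  congr 1
  rw [← sub_eq_add_neg, sub_eq_iff_eq_add]

theorem IsHomog.add {e : ℤ} {s t : KnotAlgebra F n} (hs : IsHomog e s) (ht : IsHomog e t) :
    IsHomog e (s + t) := fun d x => by rw [mul_add, map_add, hs, ht, mul_add]

theorem IsHomog.sub {e : ℤ} {s t : KnotAlgebra F n} (hs : IsHomog e s) (ht : IsHomog e t) :
    IsHomog e (s - t) := fun d x => by rw [mul_sub, map_sub, hs, ht, mul_sub]

theorem IsHomog.mul {e e' : ℤ} {s t : KnotAlgebra F n} (hs : IsHomog e s) (ht : IsHomog e' t) :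
    IsHomog (e + e') (s * t) := fun d x => by rw [← mul_assoc, ← add_assoc, ht, hs, mul_assoc]

theorem isHomog_foxW : IsHomog 0 (foxW F n) := by
  have hw : ∀ m : ℤ, IsHomog 0 ((groupUnit F n (genW n) ^ m : (KnotAlgebra F n)ˣ) :
      KnotAlgebra F n) := by
    intro m
    rw [← map_zpow, coe_groupUnit]
    have := isHomog_of (F := F) (genW n ^ m)
    rwa [deg_zpow, deg_genW, mul_zero] at this
  refine zgeomSum_induction (P := fun _ s => IsHomog 0 s) _ (fun d x => ?_)
    (fun m s h => h.add (hw m)) (fun m s h => ?_) n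
  · rw [mul_zero, mul_zero, map_zero]
  · have := h.sub (hw m)
    rwa [add_sub_cancel_right] at this

/-- For n = 0 the Fox derivative is 1. Otherwise it has parts of degree 1, 0, -1, the top one being
a W with W = `foxW F n`. The top component x' of x satisfies x' a W = 0; multiplying by w - 1 gives
x' a wⁿ = x' a, so x' = 0 because wⁿ has infinite order. Descending through the degrees kills x. -/
theorem eq_zero_of_mul_foxA {x : KnotAlgebra F n} (h : x * foxA F n = 0) : x = 0 := by
  rcases eq_or_ne n 0 with rfl | hn
  · rwa [foxA, foxW, zgeomSum_zero, mul_zero, zero_mul, add_zero, mul_one] at h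
  set a := MonoidAlgebra.of F _ (genA n) with ha
  set p := MonoidAlgebra.of F _ (genA n * (genB n)⁻¹ * (genA n)⁻¹) with hp
  have hdp : deg (genA n * (genB n)⁻¹ * (genA n)⁻¹) = -1 := by
    rw [deg_mul, deg_mul, deg_inv, deg_inv, deg_genA, deg_genB]; rfl
  have hA : IsHomog 1 a := deg_genA (n := n) ▸ isHomog_of (F := F) (genA n)
  have hP : IsHomog (-1) p := hdp ▸ isHomog_of (F := F) _
  have hfox : foxA F n = a * foxW F n + (1 - a * foxW F n * p - foxW F n) + foxW F n * p := by
    rw [foxA]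
    noncomm_ring
  have h1 : IsHomog 1 (a * foxW F n) := by simpa using hA.mul isHomog_foxW
  have h2 : IsHomog 0 (1 - a * foxW F n * p - foxW F n) := by
    refine IsHomog.sub (IsHomog.sub ?_ ?_) isHomog_foxW
    · intro d x
      rw [mul_one, mul_one, add_zero]
    · simpa using h1.mul hP
  have h3 : IsHomog (-1) (foxW F n * p) := by simpa using isHomog_foxW.mul hP
  have top : ∀ d : ℤ, (∀ e, d < e → proj e x = 0) → proj d x = 0 := by
    intro d hd
    have h4 : proj (d + 1) (x * foxA F n) = proj d x * (a * foxW F n) := by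
      have e2 : proj (d + 1) (x * (1 - a * foxW F n * p - foxW F n)) = 0 := by
        rw [← add_zero (d + 1), h2, hd _ (by omega), zero_mul]
      have e3 : proj (d + 1) (x * (foxW F n * p)) = 0 := by
        rw [show d + 1 = (d + 2) + (-1) by ring, h3, hd _ (by omega), zero_mul]
      rw [hfox, mul_add, mul_add, map_add, map_add, h1, e2, e3, add_zero, add_zero]
    rw [h, map_zero] at h4
    have h5 : proj d x * a * MonoidAlgebra.of F _ (genW n ^ n) = proj d x * a := by
      have h6 : proj d x * a * (foxW F n * (MonoidAlgebra.of F _ (genW n) - 1)) = 0 := by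
        calc _ = proj d x * (a * foxW F n) * (MonoidAlgebra.of F _ (genW n) - 1) := by
              simp only [mul_assoc]
          _ = 0 := by rw [← h4, zero_mul]
      rw [foxW_mul, mul_sub, mul_one] at h6
      exact sub_eq_zero.mp h6
    have h7 : proj d x * a = 0 := by
      refine eq_zero_of_mul_of_eq (fun m hm => ?_) h5
      rw [← zpow_mul]
      exact genW_zpow_ne_one hn (mul_ne_zero hn hm)
    have h8 := congrArg (· * MonoidAlgebra.of F _ (genA n)⁻¹) h7
    simpa only [zero_mul, mul_assoc, ha, ← map_mul, mul_inv_cancel, map_one, mul_one] using h8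
  obtain ⟨B, hB⟩ : ∃ B : ℤ, ∀ g, x.coeff g ≠ 0 → deg g ≤ B := by
    obtain ⟨B, hB⟩ := (x.coeff.support.image deg).bddAbove
    refine ⟨B, fun g hg => hB ?_⟩
    rw [Finset.mem_coe, Finset.mem_image]
    exact ⟨g, Finsupp.mem_support_iff.mpr hg, rfl⟩
  have hzero : ∀ (k : ℕ) (e : ℤ), B - k < e → proj e x = 0 := by
    intro k
    induction k with
    | zero =>
      intro e he
      apply MonoidAlgebra.coeff_injective
      ext g
      rw [coeff_proj]
      split_ifs with hg
      · by_contra h0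
        have := hB g h0
        simp at he
        omega
      · rfl
    | succ k ih =>
      intro e he
      refine top e fun e' he' => ih e' ?_
      push_cast at he
      omega
  apply MonoidAlgebra.coeff_injective
  ext g
  have h9 := hzero (B - deg g + 1).toNat (deg g) (by omega)
  have h10 := coeff_proj (deg g) x g
  rw [if_pos rfl, h9] at h10
  exact h10.symm

end Fox

end TwistKnot

namespace TwistKnot

/-! ### Complexes and projective resolutions of length two -/

section Complex

open CategoryTheory Limits ZeroObject

variable {C : Type*} [Category C] [Abelian C] {X₂ X₁ X₀ Z : C}

/-- The objects of the complex `X₂ ⟶ X₁ ⟶ X₀`. -/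
noncomputable def threeTermX (X₂ X₁ X₀ : C) : ℕ → C
  | 0 => X₀
  | 1 => X₁
  | 2 => X₂
  | _ + 3 => 0

/-- The differentials of the complex `X₂ ⟶ X₁ ⟶ X₀`. -/
noncomputable def threeTermD (d₂ : X₂ ⟶ X₁) (d₁ : X₁ ⟶ X₀) :
    ∀ n, threeTermX X₂ X₁ X₀ (n + 1) ⟶ threeTermX X₂ X₁ X₀ n
  | 0 => d₁
  | 1 => d₂
  | _ + 2 => 0

/-- The complex `X₂ ⟶ X₁ ⟶ X₀`, in degrees `2`, `1` and `0`. -/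
noncomputable def threeTerm (d₂ : X₂ ⟶ X₁) (d₁ : X₁ ⟶ X₀) (w : d₂ ≫ d₁ = 0) :
    ChainComplex C ℕ :=
  ChainComplex.of (threeTermX X₂ X₁ X₀) (threeTermD d₂ d₁)
    (fun n => match n with
      | 0 => w
      | _ + 1 => zero_comp)

theorem threeTerm_d (d₂ : X₂ ⟶ X₁) (d₁ : X₁ ⟶ X₀) (w : d₂ ≫ d₁ = 0) (n : ℕ) :
    (threeTerm d₂ d₁ w).d (n + 1) n = threeTermD d₂ d₁ n := ChainComplex.of_d _ _ _

theorem threeTerm_d_one (d₂ : X₂ ⟶ X₁) (d₁ : X₁ ⟶ X₀) (w : d₂ ≫ d₁ = 0) :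
    (threeTerm d₂ d₁ w).d 1 0 = d₁ := threeTerm_d d₂ d₁ w 0

theorem threeTerm_d_two (d₂ : X₂ ⟶ X₁) (d₁ : X₁ ⟶ X₀) (w : d₂ ≫ d₁ = 0) :
    (threeTerm d₂ d₁ w).d 2 1 = d₂ := threeTerm_d d₂ d₁ w 1

theorem isZero_threeTerm_X (d₂ : X₂ ⟶ X₁) (d₁ : X₁ ⟶ X₀) (w : d₂ ≫ d₁ = 0) (n : ℕ) :
    IsZero ((threeTerm d₂ d₁ w).X (n + 3)) := isZero_zero C

theorem exactAt_succ_iff (K : ChainComplex C ℕ) (n : ℕ) : K.ExactAt (n + 1) ↔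
    (ShortComplex.mk (K.d (n + 2) (n + 1)) (K.d (n + 1) n) (K.d_comp_d _ _ _)).Exact :=
  K.exactAt_iff' (n + 2) (n + 1) n (by simp) (by simp)

theorem exactAt_zero_iff (K : ChainComplex C ℕ) : K.ExactAt 0 ↔ Epi (K.d 1 0) := by
  rw [K.exactAt_iff' 1 0 0 (by simp) (by simp)]
  exact ShortComplex.exact_iff_epi _ (K.shape _ _ (by simp))

theorem exact_congr {A B D : C} {f f' : A ⟶ B} {g g' : B ⟶ D} (hf : f = f') (hg : g = g')
    {w : f ≫ g = 0} {w' : f' ≫ g' = 0} (h : (ShortComplex.mk f g w).Exact) :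
    (ShortComplex.mk f' g' w').Exact := by
  subst hf hg
  exact h

/-- Three-term exact sequences with projective terms are projective resolutions. -/
noncomputable def threeTermResolution (d₂ : X₂ ⟶ X₁) (d₁ : X₁ ⟶ X₀) (w : d₂ ≫ d₁ = 0)
    (ε : X₀ ⟶ Z) (wε : d₁ ≫ ε = 0) [Projective X₀] [Projective X₁] [Projective X₂]
    [Mono d₂] [Epi ε] (h₁ : (ShortComplex.mk d₂ d₁ w).Exact)
    (h₀ : (ShortComplex.mk d₁ ε wε).Exact) : ProjectiveResolution Z where
  complex := threeTerm d₂ d₁ w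
  projective n := match n with
    | 0 => inferInstanceAs (Projective X₀)
    | 1 => inferInstanceAs (Projective X₁)
    | 2 => inferInstanceAs (Projective X₂)
    | _ + 3 => inferInstanceAs (Projective (0 : C))
  π := ((threeTerm d₂ d₁ w).toSingle₀Equiv Z).symm ⟨ε, by rw [threeTerm_d_one]; exact wε⟩
  quasiIso := by
    refine ⟨fun n => ?_⟩
    -- Degree 0 needs exactness at X₀ and surjectivity of ε, degree 1 exactness at X₁, degree 2
    -- injectivity of d₂; the higher terms are zero.
    match n with
    | 0 =>
      rw [ChainComplex.quasiIsoAt₀_iff, ShortComplex.quasiIso_iff_of_zeros' _ rfl rfl rfl]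
      have h : (((threeTerm d₂ d₁ w).toSingle₀Equiv Z).symm
          ⟨ε, by rw [threeTerm_d_one]; exact wε⟩).f 0 = ε :=
        ChainComplex.toSingle₀Equiv_symm_apply_f_zero _ _
      exact ⟨exact_congr (threeTerm_d_one d₂ d₁ w).symm h.symm h₀,
        (congrArg Epi h).mpr ‹Epi ε›⟩
    | 1 =>
      rw [quasiIsoAt_iff_exactAt' (hL := ChainComplex.exactAt_succ_single_obj ..),
        exactAt_succ_iff]
      exact exact_congr (threeTerm_d_two d₂ d₁ w).symm (threeTerm_d_one d₂ d₁ w).symm h₁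
    | 2 =>
      rw [quasiIsoAt_iff_exactAt' (hL := ChainComplex.exactAt_succ_single_obj ..),
        exactAt_succ_iff]
      refine (ShortComplex.exact_iff_mono (S := ShortComplex.mk _ _ _)
        (threeTerm_d d₂ d₁ w 2)).2 ?_
      exact (congrArg Mono (threeTerm_d_two d₂ d₁ w)).mpr ‹Mono d₂›
    | n + 3 =>
      rw [quasiIsoAt_iff_exactAt' (hL := ChainComplex.exactAt_succ_single_obj ..),
        exactAt_succ_iff]
      exact ShortComplex.exact_of_isZero_X₂ _ (isZero_threeTerm_X d₂ d₁ w n)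

theorem threeTerm_map_exactAt_iff {D : Type*} [Category D] [Abelian D] (T : C ⥤ D)
    [T.Additive] (d₂ : X₂ ⟶ X₁) (d₁ : X₁ ⟶ X₀) (w : d₂ ≫ d₁ = 0) :
    (∀ i, ((T.mapHomologicalComplex _).obj (threeTerm d₂ d₁ w)).ExactAt i) ↔
      Epi (T.map d₁) ∧ (ShortComplex.mk (T.map d₂) (T.map d₁)
        (by rw [← T.map_comp, w, T.map_zero])).Exact ∧ Mono (T.map d₂) := by
  have e1 := congrArg T.map (threeTerm_d_one d₂ d₁ w)
  have e2 := congrArg T.map (threeTerm_d_two d₂ d₁ w)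
  have e3 : T.map ((threeTerm d₂ d₁ w).d 3 2) = 0 :=
    (congrArg T.map (threeTerm_d d₂ d₁ w 2)).trans (T.map_zero _ _)
  have h0 : ((T.mapHomologicalComplex _).obj (threeTerm d₂ d₁ w)).ExactAt 0 ↔
      Epi (T.map d₁) := by
    rw [exactAt_zero_iff]
    exact iff_of_eq (congrArg Epi e1)
  have h2 : ((T.mapHomologicalComplex _).obj (threeTerm d₂ d₁ w)).ExactAt 2 ↔
      Mono (T.map d₂) := by
    rw [exactAt_succ_iff]
    refine (ShortComplex.exact_iff_mono (S := ShortComplex.mk _ _ _) e3).trans ?_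
    exact iff_of_eq (congrArg Mono e2)
  refine ⟨fun h => ⟨h0.mp (h 0), exact_congr e2 e1 ((exactAt_succ_iff _ _).mp (h 1)),
    h2.mp (h 2)⟩, fun h i => ?_⟩
  match i with
  | 0 => exact h0.mpr h.1
  | 1 => exact (exactAt_succ_iff _ _).mpr (exact_congr e2.symm e1.symm h.2.1)
  | 2 => exact h2.mpr h.2.2
  | i + 3 =>
    rw [exactAt_succ_iff]
    exact ShortComplex.exact_of_isZero_X₂ _
      (T.map_isZero (isZero_threeTerm_X d₂ d₁ w i))

end Complex

end TwistKnot

namespace TwistKnot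

/-! ### The Fox resolution -/

section Resolution

open CategoryTheory Limits

theorem rep_exact {k G : Type} [Ring k] [Monoid G] (S : ShortComplex (Rep.{0} k G))
    (h : ∀ x : S.X₂, S.g.hom x = 0 → ∃ y : S.X₁, S.f.hom y = x) : S.Exact := by
  apply (forget₂ (Rep.{0} k G) (ModuleCat k)).reflects_exact_of_faithful
  rw [ShortComplex.moduleCat_exact_iff]
  exact h

section

variable {k G : Type} [CommRing k] [Group G]

/-- Right multiplication by `c` on the group algebra. -/
noncomputable def rightMul (c : MonoidAlgebra k G) :
    Rep.leftRegular k G ⟶ Rep.leftRegular k G := Rep.leftRegularHom (Rep.leftRegular k G) c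

theorem rightMul_apply (c x : MonoidAlgebra k G) : (rightMul c).hom x = x * c := by
  induction x using MonoidAlgebra.induction_linear with
  | zero => rw [zero_mul]; exact map_zero (rightMul c).hom
  | add x y hx hy => rw [add_mul, ← hx, ← hy]; exact map_add (rightMul c).hom x y
  | single g r =>
    refine (Rep.leftRegularHom_hom_single (A := Rep.leftRegular k G) g c r).trans ?_
    induction c using MonoidAlgebra.induction_linear with
    | zero => rw [mul_zero, map_zero]; exact smul_zero r
    | add x y hx hy => rw [mul_add, ← hx, ← hy, map_add]; exact smul_add r _ _
    | single g' r' =>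
      rw [MonoidAlgebra.single_mul_single]
      refine (congrArg (r • ·) (Representation.ofMulAction_single g g' r')).trans ?_
      exact MonoidAlgebra.smul_single _ _ _

theorem rightMul_ext {X : Rep.{0} k G} {f f' : Rep.leftRegular k G ⟶ X}
    (h : ∀ x : MonoidAlgebra k G, f.hom x = f'.hom x) : f = f' :=
  Rep.hom_ext (DFunLike.ext _ _ h)

theorem rightMul_comp (c c' : MonoidAlgebra k G) :
    rightMul c ≫ rightMul c' = rightMul (c * c') := by
  refine rightMul_ext fun x => ?_
  refine (rightMul_apply c' _).trans ?_
  rw [rightMul_apply, ← mul_assoc]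
  exact congrArg (· * c') (rightMul_apply c x)

theorem rightMul_add (c c' : MonoidAlgebra k G) :
    rightMul (c + c') = rightMul c + rightMul c' := by
  refine rightMul_ext fun x => ?_
  rw [rightMul_apply, mul_add, ← rightMul_apply, ← rightMul_apply]
  rfl

theorem rightMul_zero : rightMul (0 : MonoidAlgebra k G) = 0 := by
  refine rightMul_ext fun x => ?_
  rw [rightMul_apply, mul_zero]
  rfl

theorem biprod_hom_ext {X Y : Rep.{0} k G} {x y : ↥(X ⊞ Y)}
    (h₁ : (biprod.fst : X ⊞ Y ⟶ X).hom x = (biprod.fst : X ⊞ Y ⟶ X).hom y)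
    (h₂ : (biprod.snd : X ⊞ Y ⟶ Y).hom x = (biprod.snd : X ⊞ Y ⟶ Y).hom y) : x = y := by
  have h : ∀ z : ↥(X ⊞ Y), z = (biprod.inl : X ⟶ X ⊞ Y).hom ((biprod.fst : X ⊞ Y ⟶ X).hom z) +
      (biprod.inr : Y ⟶ X ⊞ Y).hom ((biprod.snd : X ⊞ Y ⟶ Y).hom z) := fun z =>
    congrArg (fun f : X ⊞ Y ⟶ X ⊞ Y => f.hom z) (biprod.total (X := X) (Y := Y)).symm
  rw [h x, h y, h₁, h₂]

/-- The sum of the coefficients. -/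
noncomputable def augmentation (k G : Type) [CommRing k] [Group G] :
    Rep.leftRegular k G ⟶ Rep.trivial k G k := Rep.leftRegularHom (Rep.trivial k G k) 1

theorem augmentation_apply (x : MonoidAlgebra k G) :
    (augmentation k G).hom x = x.coeff.sum fun _ r => r := by
  induction x using MonoidAlgebra.induction_linear with
  | zero => exact map_zero (augmentation k G).hom
  | add x y hx hy =>
    rw [MonoidAlgebra.coeff_add, Finsupp.sum_add_index' (by simp) (by simp), ← hx, ← hy]
    exact map_add (augmentation k G).hom x y
  | single g r =>
    refine (Rep.leftRegularHom_hom_single (A := Rep.trivial k G k) g 1 r).trans ?_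
    rw [MonoidAlgebra.coeff_single, Finsupp.sum_single_index rfl]
    exact mul_one r

end

variable (F : Type) [Field F] (n : ℤ)

/-- The differential in degree two of the Fox resolution. -/
noncomputable def foxD₂ : Rep.leftRegular F (KnotGroup n) ⟶
    Rep.leftRegular F (KnotGroup n) ⊞ Rep.leftRegular F (KnotGroup n) :=
  biprod.lift (rightMul (foxA F n)) (rightMul (foxB F n))

/-- The differential in degree one of the Fox resolution. -/
noncomputable def foxD₁ : Rep.leftRegular F (KnotGroup n) ⊞ Rep.leftRegular F (KnotGroup n) ⟶
    Rep.leftRegular F (KnotGroup n) :=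
  biprod.desc (rightMul (MonoidAlgebra.of F _ (genA n) - 1))
    (rightMul (MonoidAlgebra.of F _ (genB n) - 1))

theorem foxD₂_comp_foxD₁ : foxD₂ F n ≫ foxD₁ F n = 0 := by
  rw [foxD₂, foxD₁, biprod.lift_desc, rightMul_comp, rightMul_comp, ← rightMul_add,
    foxA_mul_add_foxB_mul, rightMul_zero]

theorem foxD₁_comp_augmentation : foxD₁ F n ≫ augmentation F (KnotGroup n) = 0 := by
  have h : ∀ g : KnotGroup n, rightMul (MonoidAlgebra.of F _ g - 1) ≫
      augmentation F (KnotGroup n) = 0 := by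
    intro g
    refine rightMul_ext fun x => ?_
    refine (augmentation_apply (k := F) ((rightMul _).hom x)).trans ?_
    rw [rightMul_apply]
    refine (?_ : _ = (0 : F))
    induction x using MonoidAlgebra.induction_linear with
    | zero => simp
    | add x y hx hy =>
      rw [add_mul, MonoidAlgebra.coeff_add, Finsupp.sum_add_index' (by simp) (by simp), hx, hy,
        add_zero]
    | single g' r =>
      rw [mul_sub, mul_one, MonoidAlgebra.of_apply, MonoidAlgebra.single_mul_single, mul_one,
        MonoidAlgebra.coeff_sub, Finsupp.sum_sub_index (by simp), MonoidAlgebra.coeff_single,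
        MonoidAlgebra.coeff_single, Finsupp.sum_single_index rfl, Finsupp.sum_single_index rfl,
        sub_self]
  apply biprod.hom_ext'
  · rw [foxD₁, biprod.inl_desc_assoc, h, Limits.comp_zero]
  · rw [foxD₁, biprod.inr_desc_assoc, h, Limits.comp_zero]

theorem mono_foxD₂ : Mono (foxD₂ F n) := by
  have : Mono (rightMul (foxA F n)) := by
    rw [Rep.mono_iff_injective, injective_iff_map_eq_zero]
    intro x hx
    exact eq_zero_of_mul_foxA ((rightMul_apply _ _).symm.trans hx)
  have h : foxD₂ F n ≫ biprod.fst = rightMul (foxA F n) := biprod.lift_fst _ _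
  rw [← h] at this
  exact mono_of_mono _ biprod.fst

theorem epi_augmentation : Epi (augmentation F (KnotGroup n)) := by
  rw [Rep.epi_iff_surjective]
  intro r
  refine ⟨MonoidAlgebra.single 1 r, (augmentation_apply _).trans ?_⟩
  rw [MonoidAlgebra.coeff_single, Finsupp.sum_single_index rfl]

theorem foxD₁_apply (x : ↥(Rep.leftRegular F (KnotGroup n) ⊞ Rep.leftRegular F (KnotGroup n))) :
    (foxD₁ F n).hom x =
    ((biprod.fst : Rep.leftRegular F (KnotGroup n) ⊞ Rep.leftRegular F (KnotGroup n) ⟶ _).hom x :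
      KnotAlgebra F n) * (MonoidAlgebra.of F _ (genA n) - 1) +
    ((biprod.snd : Rep.leftRegular F (KnotGroup n) ⊞ Rep.leftRegular F (KnotGroup n) ⟶ _).hom x :
      KnotAlgebra F n) * (MonoidAlgebra.of F _ (genB n) - 1) := by
  rw [foxD₁, biprod.desc_eq, Rep.add_hom]
  rw [← rightMul_apply, ← rightMul_apply]
  rfl

theorem exact_foxD₂_foxD₁ : (ShortComplex.mk _ _ (foxD₂_comp_foxD₁ F n)).Exact := by
  apply rep_exact
  intro x hx
  obtain ⟨c, h1, h2⟩ := exists_mul_fox ((foxD₁_apply F n x).symm.trans hx)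
  refine ⟨c, biprod_hom_ext ?_ ?_⟩
  · have h : foxD₂ F n ≫ biprod.fst = rightMul (foxA F n) := biprod.lift_fst _ _
    exact (congrArg (fun f => f.hom c) h).trans ((rightMul_apply _ _).trans h1.symm)
  · have h : foxD₂ F n ≫ biprod.snd = rightMul (foxB F n) := biprod.lift_snd _ _
    exact (congrArg (fun f => f.hom c) h).trans ((rightMul_apply _ _).trans h2.symm)

theorem exact_foxD₁_augmentation :
    (ShortComplex.mk _ _ (foxD₁_comp_augmentation F n)).Exact := by
  apply rep_exact
  intro x hx
  obtain ⟨u, v, huv⟩ := exists_eq_mul_sub_one (F := F) x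
  have h0 := (augmentation_apply (k := F) x).symm.trans hx
  rw [h0, MonoidAlgebra.single_zero, zero_add] at huv
  have h : biprod.lift (rightMul u) (rightMul v) ≫ foxD₁ F n = rightMul x := by
    rw [foxD₁, biprod.lift_desc, rightMul_comp, rightMul_comp, ← rightMul_add, ← huv]
  refine ⟨(biprod.lift (rightMul u) (rightMul v)).hom (1 : KnotAlgebra F n), ?_⟩
  exact (congrArg (fun f => f.hom (1 : KnotAlgebra F n)) h).trans
    ((rightMul_apply _ _).trans (one_mul x))

/-- The Fox resolution of the trivial representation. -/
noncomputable def foxResolution : ProjectiveResolution (Rep.trivial F (KnotGroup n) F) :=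
  haveI := mono_foxD₂ F n
  haveI := epi_augmentation F n
  threeTermResolution (foxD₂ F n) (foxD₁ F n) (foxD₂_comp_foxD₁ F n)
    (augmentation F (KnotGroup n)) (foxD₁_comp_augmentation F n) (exact_foxD₂_foxD₁ F n)
    (exact_foxD₁_augmentation F n)

end Resolution

end TwistKnot

namespace TwistKnot

/-! ### Homology of representations of `π n` -/

section Homology

open CategoryTheory Limits Representation TensorProduct

/-- On the antidiagonal {(u, -u)} the map (Q₁, Q₂) restricts to the isomorphism Q₁ - Q₂. Hence it is
onto and its kernel is a complement of the antidiagonal, carried isomorphically to V by addition;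
exactness means that (P₁, P₂) maps V isomorphically onto this kernel. -/
theorem exact_iff_bijective_add {F V : Type*} [Field F] [AddCommGroup V] [Module F V]
    {P₁ P₂ Q₁ Q₂ : V →ₗ[F] V} (hPQ : ∀ v, Q₁ (P₁ v) + Q₂ (P₂ v) = 0)
    (hQ : Function.Bijective (Q₁ - Q₂)) :
    ((∀ v, ∃ u u', Q₁ u + Q₂ u' = v) ∧
      (∀ u u', Q₁ u + Q₂ u' = 0 → ∃ y, P₁ y = u ∧ P₂ y = u') ∧
      (∀ y, P₁ y = 0 → P₂ y = 0 → y = 0)) ↔ Function.Bijective (P₁ + P₂) := by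
  have key : ∀ u u', u + u' = 0 → Q₁ u + Q₂ u' = 0 → u = 0 ∧ u' = 0 := by
    intro u u' h h'
    obtain rfl := eq_neg_of_add_eq_zero_right h
    have hu : u = 0 := (injective_iff_map_eq_zero _).mp hQ.1 u (by
      rwa [map_neg, ← sub_eq_add_neg] at h')
    exact ⟨hu, by rw [hu, neg_zero]⟩
  constructor
  · rintro ⟨_, h₁, h₂⟩
    refine ⟨(injective_iff_map_eq_zero _).mpr fun y hy => ?_, fun v => ?_⟩
    · obtain ⟨h3, h4⟩ := key (P₁ y) (P₂ y) hy (hPQ y)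
      exact h₂ y h3 h4
    · obtain ⟨u, hu⟩ := hQ.2 (Q₁ v)
      obtain ⟨y, hy, hy'⟩ := h₁ (v - u) u (by
        rw [map_sub, ← hu, LinearMap.sub_apply]
        abel)
      refine ⟨y, ?_⟩
      rw [LinearMap.add_apply, hy, hy', sub_add_cancel]
  · intro h
    refine ⟨fun v => ?_, fun u u' hu => ?_, fun y h₁ h₂ => ?_⟩
    · obtain ⟨u, hu⟩ := hQ.2 v
      exact ⟨u, -u, by rw [map_neg, ← sub_eq_add_neg, ← LinearMap.sub_apply, hu]⟩
    · obtain ⟨y, hy⟩ := h.2 (u + u')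
      rw [LinearMap.add_apply] at hy
      obtain ⟨h3, h4⟩ := key (u - P₁ y) (u' - P₂ y)
        (by rw [sub_add_sub_comm, hy, sub_self])
        (by rw [map_sub, map_sub, sub_add_sub_comm, hu, hPQ, sub_zero])
      exact ⟨y, (sub_eq_zero.mp h3).symm, (sub_eq_zero.mp h4).symm⟩
    · refine (injective_iff_map_eq_zero _).mp h.1 y ?_
      rw [LinearMap.add_apply, h₁, h₂, add_zero]

theorem map_biprod_hom_ext {C F : Type*} [Category C] [Preadditive C] [HasBinaryBiproducts C]
    [Ring F] (T : C ⥤ ModuleCat F) [T.Additive] {X Y : C} {x y : T.obj (X ⊞ Y)}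
    (h₁ : (T.map biprod.fst).hom x = (T.map biprod.fst).hom y)
    (h₂ : (T.map biprod.snd).hom x = (T.map biprod.snd).hom y) : x = y := by
  have h : ∀ z : T.obj (X ⊞ Y), z = (T.map biprod.inl).hom ((T.map biprod.fst).hom z) +
      (T.map biprod.inr).hom ((T.map biprod.snd).hom z) := by
    intro z
    have := congrArg T.map (biprod.total (X := X) (Y := Y))
    rw [T.map_add, T.map_comp, T.map_comp, T.map_id] at this
    exact (congrArg (fun f => f.hom z) this).symm
  rw [h x, h y, h₁, h₂]

variable {k G : Type} [CommRing k] [Group G] (A : Rep.{0} k G)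

/-- The identification of `(A ⊗ k[G])_G` with `A`. -/
noncomputable def tensorEquiv :
    ((Rep.coinvariantsTensor k G).obj A).obj (Rep.leftRegular k G) ≃ₗ[k] A :=
  coinvariantsTprodLeftRegularLEquiv A.ρ

/-- The right action of the group algebra on a representation. -/
noncomputable def rightAct (c : MonoidAlgebra k G) : A →ₗ[k] A :=
  (tensorEquiv A).toLinearMap ∘ₗ
    (((Rep.coinvariantsTensor k G).obj A).map (rightMul c)).hom ∘ₗ
      (tensorEquiv A).symm.toLinearMap

theorem tensorEquiv_map (c : MonoidAlgebra k G) (x) :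
    tensorEquiv A ((((Rep.coinvariantsTensor k G).obj A).map (rightMul c)).hom x) =
      rightAct A c (tensorEquiv A x) := by
  simp [rightAct]

theorem rightAct_add (c c' : MonoidAlgebra k G) :
    rightAct A (c + c') = rightAct A c + rightAct A c' := by
  rw [rightAct, rightMul_add, Functor.map_add, ModuleCat.hom_add]
  ext v
  simp [rightAct]

theorem rightAct_zero : rightAct A 0 = 0 := by
  rw [rightAct, rightMul_zero, Functor.map_zero, ModuleCat.hom_zero]
  ext v
  simp

/-- In the coinvariants v ⊗ g is identified with g⁻¹ v ⊗ 1, whence the inverse. -/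
theorem rightAct_single (g : G) (r : k) (v : A) :
    rightAct A (MonoidAlgebra.single g r) v = r • A.ρ g⁻¹ v := by
  have h1 : (tensorEquiv A).symm v =
      Coinvariants.mk (A.ρ.tprod (leftRegular k G)) (v ⊗ₜ[k] MonoidAlgebra.single 1 1) := rfl
  have h2 : (((Rep.coinvariantsTensor k G).obj A).map (rightMul (MonoidAlgebra.single g r))).hom
      (Coinvariants.mk (A.ρ.tprod (leftRegular k G)) (v ⊗ₜ[k] MonoidAlgebra.single 1 1)) =
      Coinvariants.mk (A.ρ.tprod (leftRegular k G))
        (v ⊗ₜ[k] (rightMul (MonoidAlgebra.single g r)).hom (MonoidAlgebra.single 1 1)) := rfl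
  have h3 : rightAct A (MonoidAlgebra.single g r) v = tensorEquiv A
      ((((Rep.coinvariantsTensor k G).obj A).map (rightMul (MonoidAlgebra.single g r))).hom
        ((tensorEquiv A).symm v)) := rfl
  have h4 : (rightMul (MonoidAlgebra.single g r)).hom (MonoidAlgebra.single 1 1) =
      MonoidAlgebra.single g r := (rightMul_apply _ _).trans (one_mul _)
  rw [h3, h1, h2, h4]
  exact ofCoinvariantsTprodLeftRegular_mk_tmul_single A.ρ v g r

theorem rightAct_mul (c c' : MonoidAlgebra k G) :
    rightAct A (c * c') = rightAct A c' ∘ₗ rightAct A c := by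
  ext v
  obtain ⟨x, rfl⟩ := (tensorEquiv A).surjective v
  rw [LinearMap.comp_apply, ← tensorEquiv_map, ← tensorEquiv_map, ← tensorEquiv_map,
    ← rightMul_comp, Functor.map_comp, ModuleCat.hom_comp, LinearMap.comp_apply]

section

variable {F : Type} [Field F] {n : ℤ} (A : Rep.{0} F (KnotGroup n))

theorem exists_tensor_biprod (u v : A) :
    ∃ x : ((Rep.coinvariantsTensor F (KnotGroup n)).obj A).obj
      (Rep.leftRegular F (KnotGroup n) ⊞ Rep.leftRegular F (KnotGroup n)),
    tensorEquiv A ((((Rep.coinvariantsTensor F (KnotGroup n)).obj A).map biprod.fst).hom x) = u ∧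
    tensorEquiv A
      ((((Rep.coinvariantsTensor F (KnotGroup n)).obj A).map biprod.snd).hom x) = v := by
  set T := (Rep.coinvariantsTensor F (KnotGroup n)).obj A
  have h11 : T.map (biprod.inl (X := Rep.leftRegular F (KnotGroup n))
      (Y := Rep.leftRegular F (KnotGroup n))) ≫ T.map biprod.fst = 𝟙 _ := by
    rw [← T.map_comp, biprod.inl_fst, T.map_id]
  have h12 : T.map (biprod.inl (X := Rep.leftRegular F (KnotGroup n))
      (Y := Rep.leftRegular F (KnotGroup n))) ≫ T.map biprod.snd = 0 := by
    rw [← T.map_comp, biprod.inl_snd, T.map_zero]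
  have h21 : T.map (biprod.inr (X := Rep.leftRegular F (KnotGroup n))
      (Y := Rep.leftRegular F (KnotGroup n))) ≫ T.map biprod.fst = 0 := by
    rw [← T.map_comp, biprod.inr_fst, T.map_zero]
  have h22 : T.map (biprod.inr (X := Rep.leftRegular F (KnotGroup n))
      (Y := Rep.leftRegular F (KnotGroup n))) ≫ T.map biprod.snd = 𝟙 _ := by
    rw [← T.map_comp, biprod.inr_snd, T.map_id]
  refine ⟨(T.map biprod.inl).hom ((tensorEquiv A).symm u) +
    (T.map biprod.inr).hom ((tensorEquiv A).symm v), ?_, ?_⟩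
  · rw [map_add, ← LinearMap.comp_apply, ← LinearMap.comp_apply, ← ModuleCat.hom_comp,
      ← ModuleCat.hom_comp, h11, h21]
    simp
  · rw [map_add, ← LinearMap.comp_apply, ← LinearMap.comp_apply, ← ModuleCat.hom_comp,
      ← ModuleCat.hom_comp, h12, h22]
    simp

theorem tensor_foxD₁ (x) :
    tensorEquiv A ((((Rep.coinvariantsTensor F (KnotGroup n)).obj A).map (foxD₁ F n)).hom x) =
    rightAct A (MonoidAlgebra.of F _ (genA n) - 1)
      (tensorEquiv A ((((Rep.coinvariantsTensor F (KnotGroup n)).obj A).map biprod.fst).hom x)) +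
    rightAct A (MonoidAlgebra.of F _ (genB n) - 1)
      (tensorEquiv A ((((Rep.coinvariantsTensor F (KnotGroup n)).obj A).map biprod.snd).hom x)) := by
  rw [← tensorEquiv_map, ← tensorEquiv_map, foxD₁, biprod.desc_eq, Functor.map_add,
    Functor.map_comp, Functor.map_comp, ModuleCat.hom_add, LinearMap.add_apply, map_add]
  rfl

theorem tensor_foxD₂_fst (x) :
    tensorEquiv A ((((Rep.coinvariantsTensor F (KnotGroup n)).obj A).map biprod.fst).hom
      ((((Rep.coinvariantsTensor F (KnotGroup n)).obj A).map (foxD₂ F n)).hom x)) =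
    rightAct A (foxA F n) (tensorEquiv A x) := by
  rw [← tensorEquiv_map, ← LinearMap.comp_apply, ← ModuleCat.hom_comp, ← Functor.map_comp,
    foxD₂, biprod.lift_fst]

theorem tensor_foxD₂_snd (x) :
    tensorEquiv A ((((Rep.coinvariantsTensor F (KnotGroup n)).obj A).map biprod.snd).hom
      ((((Rep.coinvariantsTensor F (KnotGroup n)).obj A).map (foxD₂ F n)).hom x)) =
    rightAct A (foxB F n) (tensorEquiv A x) := by
  rw [← tensorEquiv_map, ← LinearMap.comp_apply, ← ModuleCat.hom_comp, ← Functor.map_comp,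
    foxD₂, biprod.lift_snd]

/-- Group homology can be computed from the Fox resolution. Tensoring with A gives A → A² → A, whose
maps are the right actions of the Fox derivatives and of a - 1 and b - 1, and
`exact_iff_bijective_add` applies. -/
theorem forall_subsingleton_groupHomology_iff
    (hQ : Function.Bijective (rightAct A (MonoidAlgebra.of F _ (genA n) - 1) -
      rightAct A (MonoidAlgebra.of F _ (genB n) - 1))) :
    (∀ i, Subsingleton (groupHomology A i)) ↔
      Function.Bijective (rightAct A (foxA F n) + rightAct A (foxB F n)) := by
  classical
  have hPQ : ∀ v, rightAct A (MonoidAlgebra.of F _ (genA n) - 1) (rightAct A (foxA F n) v) +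
      rightAct A (MonoidAlgebra.of F _ (genB n) - 1) (rightAct A (foxB F n) v) = 0 := by
    intro v
    rw [← LinearMap.comp_apply, ← LinearMap.comp_apply, ← rightAct_mul, ← rightAct_mul,
      ← LinearMap.add_apply, ← rightAct_add, foxA_mul_add_foxB_mul, rightAct_zero,
      LinearMap.zero_apply]
  have h1 : ∀ i, Subsingleton (groupHomology A i) ↔
      ((((Rep.coinvariantsTensor F (KnotGroup n)).obj A).mapHomologicalComplex _).obj
        (threeTerm (foxD₂ F n) (foxD₁ F n) (foxD₂_comp_foxD₁ F n))).ExactAt i := by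
    intro i
    rw [HomologicalComplex.exactAt_iff_isZero_homology, ← ModuleCat.isZero_iff_subsingleton]
    exact (groupHomologyIso A i (foxResolution F n)).isZero_iff
  rw [forall_congr' h1, threeTerm_map_exactAt_iff, ← exact_iff_bijective_add hPQ hQ,
    ModuleCat.epi_iff_surjective, ModuleCat.mono_iff_injective, ShortComplex.moduleCat_exact_iff]
  refine and_congr ?_ (and_congr ?_ ?_)
  · constructor
    · intro h v
      obtain ⟨x, hx⟩ := h ((tensorEquiv A).symm v)
      refine ⟨_, _, (tensor_foxD₁ A x).symm.trans ?_⟩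
      exact (congrArg (tensorEquiv A) hx).trans ((tensorEquiv A).apply_symm_apply v)
    · intro h x
      obtain ⟨u, v, huv⟩ := h (tensorEquiv A x)
      obtain ⟨y, rfl, rfl⟩ := exists_tensor_biprod A u v
      exact ⟨y, (tensorEquiv A).injective ((tensor_foxD₁ A y).trans huv)⟩
  · constructor
    · intro h u v huv
      obtain ⟨x, rfl, rfl⟩ := exists_tensor_biprod A u v
      obtain ⟨y, rfl⟩ := h x ((tensorEquiv A).injective
        (((tensor_foxD₁ A x).trans huv).trans (map_zero _).symm))
      exact ⟨_, (tensor_foxD₂_fst A y).symm, (tensor_foxD₂_snd A y).symm⟩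
    · intro h x hx
      obtain ⟨y, h1, h2⟩ := h _ _ ((tensor_foxD₁ A x).symm.trans
        ((congrArg (tensorEquiv A) hx).trans (map_zero _)))
      refine ⟨(tensorEquiv A).symm y, map_biprod_hom_ext
        ((Rep.coinvariantsTensor F (KnotGroup n)).obj A) ?_ ?_⟩
      · apply (tensorEquiv A).injective
        refine (tensor_foxD₂_fst A _).trans ?_
        rw [LinearEquiv.apply_symm_apply, h1]
      · apply (tensorEquiv A).injective
        refine (tensor_foxD₂_snd A _).trans ?_
        rw [LinearEquiv.apply_symm_apply, h2]
  · constructor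
    · intro h y h1 h2
      have : (tensorEquiv A).symm y = 0 := by
        apply h
        refine (map_biprod_hom_ext _ ?_ ?_).trans (map_zero _).symm
        · apply (tensorEquiv A).injective
          refine (tensor_foxD₂_fst A _).trans ?_
          rw [LinearEquiv.apply_symm_apply, h1, map_zero, map_zero]
        · apply (tensorEquiv A).injective
          refine (tensor_foxD₂_snd A _).trans ?_
          rw [LinearEquiv.apply_symm_apply, h2, map_zero, map_zero]
      exact (LinearEquiv.map_eq_zero_iff _).mp this
    · intro h
      refine (injective_iff_map_eq_zero _).mpr fun x hx => ?_
      refine (LinearEquiv.map_eq_zero_iff (tensorEquiv A)).mp (h _ ?_ ?_)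
      · refine (tensor_foxD₂_fst A x).symm.trans ?_
        rw [hx, map_zero, map_zero]
      · refine (tensor_foxD₂_snd A x).symm.trans ?_
        rw [hx, map_zero, map_zero]

end

end Homology

end TwistKnot

namespace TwistKnot

open Matrix

/-! ### The group algebra acting through 2 × 2 matrices. -/

section LinRep

/-- The extension of `ρ` to the group algebra. -/
noncomputable def matrixHom {G F : Type} [Group G] [Field F]
    (ρ : G →* SpecialLinearGroup (Fin 2) F) :
    MonoidAlgebra F G →ₐ[F] Matrix (Fin 2) (Fin 2) F :=
  MonoidAlgebra.lift F (Matrix (Fin 2) (Fin 2) F) G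
    { toFun := fun g => (ρ g : Matrix (Fin 2) (Fin 2) F)
      map_one' := by rw [map_one]; rfl
      map_mul' := fun g g' => by rw [map_mul]; rfl }

theorem matrixHom_of {G F : Type} [Group G] [Field F]
    (ρ : G →* SpecialLinearGroup (Fin 2) F) (g : G) :
    matrixHom ρ (MonoidAlgebra.of F G g) = (ρ g : Matrix (Fin 2) (Fin 2) F) :=
  MonoidAlgebra.lift_of _ _

theorem adjugate_add_fin_two {R : Type*} [CommRing R] (A B : Matrix (Fin 2) (Fin 2) R) :
    adjugate (A + B) = adjugate A + adjugate B := by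
  ext i j
  fin_cases i <;> fin_cases j <;> simp [adjugate_fin_two, add_comm]

theorem adjugate_smul_fin_two {R : Type*} [CommRing R] (r : R) (A : Matrix (Fin 2) (Fin 2) R) :
    adjugate (r • A) = r • adjugate A := by
  ext i j
  fin_cases i <;> fin_cases j <;> simp [adjugate_fin_two]

theorem det_adjugate_fin_two {R : Type*} [CommRing R] (A : Matrix (Fin 2) (Fin 2) R) :
    (adjugate A).det = A.det := by
  simp [adjugate_fin_two, det_fin_two, mul_comm]

/-- In SL₂ the inverse is the adjugate, and for 2 × 2 matrices the adjugate is linear, so the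
formula extends from group elements to the group algebra. The adjugate has the same determinant, so
invertibility can be tested on `matrixHom ρ c`. -/
theorem rightAct_linRep {G F : Type} [Group G] [Field F]
    (ρ : G →* SpecialLinearGroup (Fin 2) F) (c : MonoidAlgebra F G) :
    rightAct (Rep.of (linRep ρ)) c = Matrix.toLin' (adjugate (matrixHom ρ c)) := by
  induction c using MonoidAlgebra.induction_linear with
  | zero => rw [rightAct_zero, map_zero, adjugate_zero, map_zero]
  | add c c' hc hc' => rw [rightAct_add, hc, hc', map_add, adjugate_add_fin_two, map_add]
  | single g r =>
    have h : MonoidAlgebra.single g r = r • MonoidAlgebra.of F G g := by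
      rw [MonoidAlgebra.of_apply, MonoidAlgebra.smul_single, smul_eq_mul, mul_one]
    have h' : matrixHom ρ (MonoidAlgebra.single g r) = r • (ρ g : Matrix (Fin 2) (Fin 2) F) := by
      rw [h, map_smul, matrixHom_of]
    rw [h', adjugate_smul_fin_two, ← coe_inv_eq_adjugate, ← map_inv, map_smul]
    exact LinearMap.ext fun v => rightAct_single (Rep.of (linRep ρ)) g r v

theorem toLin'_bijective_iff {F : Type*} [Field F] (A : Matrix (Fin 2) (Fin 2) F) :
    Function.Bijective (Matrix.toLin' A) ↔ A.det ≠ 0 := by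
  rw [← Module.End.isUnit_iff, LinearMap.isUnit_iff_isUnit_det, LinearMap.det_toLin',
    isUnit_iff_ne_zero]

end LinRep

/-! ### Irreducibility and acyclicity in terms of the traces. -/

section Acyclic

variable {F : Type} [Field F] {n : ℤ} {α β : F}
  {ρ : KnotGroup n →* SpecialLinearGroup (Fin 2) F}

theorem trace_genB (tA : (ρ (genA n) : Matrix (Fin 2) (Fin 2) F).trace = α) :
    (ρ (genB n) : Matrix (Fin 2) (Fin 2) F).trace = α := by
  have h : genB n = (genW n ^ n)⁻¹ * genA n * genW n ^ n := by
    rw [mul_assoc, genA_mul_zpow, inv_mul_cancel_left]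
  rw [h, map_mul, map_mul, coe_mul_eq, Matrix.trace_mul_comm, ← coe_mul_eq, ← mul_assoc,
    ← map_mul, mul_inv_cancel, map_one, one_mul, tA]

/-- Since det (A - B) = β + 2 - α² is nonzero, the homology vanishes exactly when the image of `foxA
F n + foxB F n` is invertible; `det_foxSum` evaluates its determinant. -/
theorem isAcyclic_iff (hρ : HasTraces ρ α β) (hf : fVal n α β = 0) (hz : zVal α β ≠ 2) :
    IsAcyclic ρ ↔ τVal n α β ≠ 0 := by
  obtain ⟨tA, tAB⟩ := hρ
  have tB := trace_genB tA
  rw [map_mul, coe_mul_eq] at tAB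
  have hβ : β + 2 - α ^ 2 ≠ 0 := by
    intro h
    refine hz (sub_eq_zero.mp ?_)
    rw [zVal_sub_two, h, mul_zero]
  have hQ : Function.Bijective
      (rightAct (Rep.of (linRep ρ)) (MonoidAlgebra.of F _ (genA n) - 1) -
      rightAct (Rep.of (linRep ρ)) (MonoidAlgebra.of F _ (genB n) - 1)) := by
    have h : rightAct (Rep.of (linRep ρ)) (MonoidAlgebra.of F _ (genA n) - 1) -
        rightAct (Rep.of (linRep ρ)) (MonoidAlgebra.of F _ (genB n) - 1) =
        rightAct (Rep.of (linRep ρ))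
          (MonoidAlgebra.of F _ (genA n) - MonoidAlgebra.of F _ (genB n)) := by
      rw [sub_eq_iff_eq_add, ← rightAct_add]
      congr 1
      abel
    rw [h, rightAct_linRep]
    refine (toLin'_bijective_iff _).mpr ?_
    rw [det_adjugate_fin_two, map_sub, matrixHom_of, matrixHom_of, det_sub tA tB tAB]
    exact hβ
  have hW : matrixHom ρ (foxW F n) * (((ρ (genA n) * (ρ (genB n))⁻¹ * (ρ (genA n))⁻¹ *
      ρ (genB n) : SpecialLinearGroup (Fin 2) F) : Matrix (Fin 2) (Fin 2) F) - 1) =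
      (((ρ (genA n) * (ρ (genB n))⁻¹ * (ρ (genA n))⁻¹ *
      ρ (genB n)) ^ n : SpecialLinearGroup (Fin 2) F) : Matrix (Fin 2) (Fin 2) F) - 1 := by
    have h := congrArg (matrixHom ρ) (foxW_mul (F := F) (n := n))
    rw [map_mul, map_sub, map_sub, matrixHom_of, matrixHom_of, map_one, map_zpow, genW, map_mul,
      map_mul, map_mul, map_inv, map_inv] at h
    exact h
  have hsum : matrixHom ρ (foxA F n + foxB F n) =
      1 - (((ρ (genA n) * (ρ (genB n))⁻¹ * (ρ (genA n))⁻¹ *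
      ρ (genB n)) ^ n : SpecialLinearGroup (Fin 2) F) : Matrix (Fin 2) (Fin 2) F) +
      ((ρ (genA n) : Matrix (Fin 2) (Fin 2) F) - 1) * matrixHom ρ (foxW F n) *
        (1 - (ρ (genA n) : Matrix (Fin 2) (Fin 2) F) *
          (((ρ (genB n))⁻¹ : SpecialLinearGroup (Fin 2) F) : Matrix (Fin 2) (Fin 2) F)) := by
    have h : foxA F n + foxB F n = 1 - MonoidAlgebra.of F _ (genW n ^ n) +
        (MonoidAlgebra.of F _ (genA n) - 1) * foxW F n *
          (1 - MonoidAlgebra.of F _ (genA n * (genB n)⁻¹)) := by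
      rw [foxA, foxB]
      noncomm_ring
    rw [h, map_add, map_sub, map_mul, map_mul, map_sub, map_sub, map_one, matrixHom_of,
      matrixHom_of, matrixHom_of, map_mul, map_inv, coe_mul_eq, map_zpow, genW, map_mul, map_mul,
      map_mul, map_inv, map_inv]
  have hdet := det_foxSum tA tB tAB n hf hz _ hW
  rw [← hsum] at hdet
  refine (forall_subsingleton_groupHomology_iff (Rep.of (linRep ρ)) hQ).trans ?_
  rw [← rightAct_add, rightAct_linRep]
  refine (toLin'_bijective_iff _).trans ?_
  rw [det_adjugate_fin_two, hdet]
  exact ⟨left_ne_zero_of_mul, fun h => mul_ne_zero h hβ⟩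

theorem isAbsIrreducible_iff_zVal_ne_two (hρ : HasTraces ρ α β) :
    IsAbsIrreducible ρ ↔ zVal α β ≠ 2 := by
  obtain ⟨tA, tAB⟩ := hρ
  rw [map_mul, coe_mul_eq] at tAB
  rw [isAbsIrreducible_iff ρ (closure_genA_genB n), det_mul_sub_mul tA (trace_genB tA) tAB,
    sub_ne_zero, ne_comm]

/-- The relation kills f (A - B), and A ≠ B because det (A - B) is a factor of z - 2. -/
theorem fVal_eq_zero (hρ : HasTraces ρ α β) (hz : zVal α β ≠ 2) : fVal n α β = 0 := by
  obtain ⟨tA, tAB⟩ := hρ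
  have tB := trace_genB tA
  rw [map_mul, coe_mul_eq] at tAB
  have h := mul_zpow_sub tA tB tAB n
  have h1 := congrArg ρ (genA_mul_zpow n)
  rw [map_mul, map_mul, map_zpow, genW, map_mul, map_mul, map_mul, map_inv, map_inv] at h1
  rw [← coe_mul_eq, ← coe_mul_eq, h1, sub_self] at h
  refine (smul_eq_zero.mp h.symm).resolve_right fun h2 => hz (sub_eq_zero.mp ?_)
  rw [zVal_sub_two, ← det_sub tA tB tAB, h2, det_zero, mul_zero]

end Acyclic

/-! ### The values of f, τ and k on the diagonal of a field. -/

section Roots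

variable {F : Type*} [Field F] {n : ℤ} {α : F}

theorem zVal_self_sub_two (α : F) : zVal α α - 2 = -((α - 2) ^ 2 * (α + 1)) := by
  rw [zVal]; ring

theorem aeval_diagZ (α : F) : aeval α diagZ = zVal α α := by
  rw [diagZ, zVal]
  simp only [map_sub, map_add, map_neg, map_mul, map_pow, aeval_X, map_ofNat]
  ring

theorem aeval_aeval_diagZ (α : F) (p : ℤ[X]) :
    aeval α (aeval diagZ p) = aeval (zVal α α) p := by
  rw [← aeval_diagZ]
  exact (aeval_algHom_apply (aeval α : ℤ[X] →ₐ[ℤ] F) diagZ p).symm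

theorem fVal_self (n : ℤ) (α : F) : fVal n α α = aeval α (g n) * aeval α (k n) := by
  rw [← map_mul, ← diag_f_eq, diag_f, fVal]
  simp only [map_sub, map_mul, aeval_X, map_one, aeval_aeval_diagZ]

theorem τVal_self (n : ℤ) (α : F) : τVal n α α = 2 * aeval α (h n) * aeval α (k n) := by
  have h1 : (2 * aeval α (h n) * aeval α (k n) : F) = aeval α (2 * h n * k n) := by
    rw [map_mul, map_mul, map_ofNat]
  rw [h1, ← diag_τ_eq, diag_τ, τVal]
  simp only [map_add, map_sub, map_mul, aeval_X, map_ofNat, aeval_aeval_diagZ]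

theorem aeval_k_eq_zero (h2 : (2 : F) ≠ 0) (hf : fVal n α α = 0) (hτ : τVal n α α = 0) :
    aeval α (k n) = 0 := by
  rw [fVal_self] at hf
  rw [τVal_self] at hτ
  by_contra hk
  have hg := (mul_eq_zero.mp hf).resolve_right hk
  have hh := (mul_eq_zero.mp ((mul_eq_zero.mp hτ).resolve_right hk)).resolve_left h2
  obtain ⟨u, v, huv⟩ := isCoprime_g_h n
  have := congrArg (aeval α) huv
  rw [map_add, map_mul, map_mul, hg, hh, mul_zero, mul_zero, add_zero, map_one] at this
  exact zero_ne_one this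

/-- As -1 = 2 cos (2π/3), the Chebyshev values at -1 have period 3. -/
theorem aeval_neg_one_cheb (m : ℤ) : aeval (-1 : F) (cheb (3 * m)) = 0 ∧
    aeval (-1 : F) (cheb (3 * m + 1)) = 1 := by
  have hrec := aeval_cheb_rec (-1 : F)
  induction m using Int.induction_on with
  | zero => simp [cheb_zero, cheb_one]
  | succ i ih =>
    have e2 := hrec (3 * i + 1)
    have e3 := hrec (3 * i + 1 + 1)
    have e4 := hrec (3 * i + 1 + 1 + 1)
    rw [add_sub_cancel_right] at e2 e3 e4
    rw [show 3 * ((i : ℤ) + 1) = 3 * i + 1 + 1 + 1 by ring]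
    exact ⟨by linear_combination e3 - e2 + ih.1, by linear_combination e4 - e3 + ih.2⟩
  | pred i ih =>
    have e2 := hrec (3 * (-i) - 1 + 1)
    have e3 := hrec (3 * (-i) - 1)
    have e4 := hrec (3 * (-i) - 1 - 1)
    rw [sub_add_cancel] at e2 e3 e4
    rw [show 3 * (-(i : ℤ) - 1) = 3 * (-i) - 1 - 1 - 1 by ring, sub_add_cancel]
    exact ⟨by linear_combination e4 - e3 + ih.1, by linear_combination e3 - e2 + ih.2⟩

/-- At x = 2 the argument 1 - x is -1, and k takes the value -1 or 1. So the reducible point α = 2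
is never a root, and only α = -1 has to be excluded. -/
theorem aeval_two_k_ne_zero (n : ℤ) : aeval (2 : F) (k n) ≠ 0 := by
  have hc : ∀ p : ℤ[X], aeval (2 : F) (aeval (1 - X : ℤ[X]) p) = aeval (-1 : F) p := by
    intro p
    have h : (-1 : F) = aeval (2 : F) (1 - X : ℤ[X]) := by
      rw [map_sub, map_one, aeval_X]; norm_num
    rw [h]
    exact (aeval_algHom_apply (aeval (2 : F) : ℤ[X] →ₐ[ℤ] F) _ p).symm
  obtain ⟨m, rfl | rfl⟩ := Int.even_or_odd' n
  · have h := aeval_cheb_rec (-1 : F) (3 * m)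
    obtain ⟨h0, h1⟩ := aeval_neg_one_cheb (F := F) m
    rw [(k_eq_cheb m).1, map_add, hc, hc, h0, zero_add]
    intro h'
    rw [h0, h1, h'] at h
    simp at h
  · rw [(k_eq_cheb m).2, hc, (aeval_neg_one_cheb m).2]
    exact one_ne_zero

end Roots

/-! ### From intertwining the generators to conjugacy of representations. -/

section Intertwine

variable {R : Type*} [Ring R] {P M N M' N' : R}

theorem intertwine_mul (h : P * M = M' * P) (h' : P * N = N' * P) :
    P * (M * N) = M' * N' * P := by
  rw [← mul_assoc, h, mul_assoc, h', mul_assoc]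

theorem intertwine_inv (hN : M * N = 1) (hN' : N' * M' = 1) (h : P * M = M' * P) :
    P * N = N' * P := by
  calc P * N = N' * (M' * P) * N := by rw [← mul_assoc N', hN', one_mul]
    _ = N' * P := by rw [← h, mul_assoc, mul_assoc, hN, mul_one]

theorem eq_conj_of_intertwine (hN : P * N = 1) (h : P * M = M' * P) : M' = P * M * N := by
  rw [h, mul_assoc, hN, mul_one]

end Intertwine

theorem isConjugate_of_hasTraces {F : Type} [Field F] {n : ℤ} {α β : F}
    {ρ ρ' : KnotGroup n →* SpecialLinearGroup (Fin 2) F} (hρ : IsAbsIrreducible ρ)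
    (hρ' : IsAbsIrreducible ρ') (t : HasTraces ρ α β) (t' : HasTraces ρ' α β) :
    IsConjugate ρ ρ' := by
  rw [isAbsIrreducible_iff _ (closure_genA_genB n)] at hρ hρ'
  obtain ⟨tA, tAB⟩ := t
  obtain ⟨tA', tAB'⟩ := t'
  rw [map_mul, coe_mul_eq] at tAB tAB'
  obtain ⟨P, hP, hPA, hPB⟩ := exists_intertwiner (ρ (genA n)).2 (ρ (genB n)).2 tA
    (trace_genB tA) tAB hρ (ρ' (genA n)).2 (ρ' (genB n)).2 tA' (trace_genB tA') tAB' hρ'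
  have key : ∀ γ, P * (ρ γ : Matrix (Fin 2) (Fin 2) F) =
      (ρ' γ : Matrix (Fin 2) (Fin 2) F) * P := by
    intro γ
    induction γ using knotGroup_induction with
    | hA => exact hPA
    | hB => exact hPB
    | one =>
      rw [map_one, map_one]
      exact (mul_one P).trans (one_mul P).symm
    | mul γ δ ih ih' =>
      rw [map_mul, map_mul]
      exact intertwine_mul ih ih'
    | inv γ ih =>
      rw [map_inv, map_inv]
      refine intertwine_inv ?_ ?_ ih
      · rw [← coe_mul_eq, mul_inv_cancel]; rfl
      · rw [← coe_mul_eq, inv_mul_cancel]; rfl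
  refine ⟨GeneralLinearGroup.mkOfDetNeZero P hP, fun γ => ?_⟩
  exact eq_conj_of_intertwine (GeneralLinearGroup.mkOfDetNeZero P hP).mul_inv (key γ)

end TwistKnot

/-! ### The correspondence between representations and roots of k. -/

namespace TwistKnot

open Matrix

variable {n : ℤ} {F : Type} [Field F]

theorem exists_root_of_not_isAcyclic (h2 : (2 : F) ≠ 0)
    {ρ : KnotGroup n →* SpecialLinearGroup (Fin 2) F} (hρ : IsAbsIrreducible ρ)
    (hac : ¬ IsAcyclic ρ) :
    ∃ α : F, aeval α (k n) = 0 ∧ α ≠ -1 ∧ HasTraces ρ α α := by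
  obtain ⟨α, β, ht⟩ : ∃ α β, HasTraces ρ α β := ⟨_, _, rfl, rfl⟩
  have hz := (isAbsIrreducible_iff_zVal_ne_two ht).mp hρ
  have hf := fVal_eq_zero ht hz
  have hτ : τVal n α β = 0 := by
    by_contra h
    exact hac ((isAcyclic_iff ht hf hz).mpr h)
  obtain rfl := eq_of_fVal_of_τVal h2 hf hτ hz
  refine ⟨β, aeval_k_eq_zero h2 hf hτ, ?_, ht⟩
  -- At α = β = -1 one has z = 2, contradicting irreducibility.
  rintro rfl
  refine hz (sub_eq_zero.mp ?_)
  rw [zVal_self_sub_two]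
  ring

theorem exists_hom_of_root [Finite F] (h2 : (2 : F) ≠ 0) {α : F} (hk : aeval α (k n) = 0)
    (hα : α ≠ -1) : ∃ ρ : KnotGroup n →* SpecialLinearGroup (Fin 2) F,
      IsAbsIrreducible ρ ∧ ¬ IsAcyclic ρ ∧ HasTraces ρ α α := by
  obtain ⟨A, B, tA, tB, tAB⟩ := exists_pair_of_traces h2 α
  have hf : fVal n α α = 0 := by rw [fVal_self, hk, mul_zero]
  have hτ : τVal n α α = 0 := by rw [τVal_self, hk, mul_zero]
  have hz : zVal α α ≠ 2 := by
    rw [← sub_ne_zero, zVal_self_sub_two, neg_ne_zero]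
    refine mul_ne_zero (pow_ne_zero 2 (sub_ne_zero.mpr ?_)) ?_
    · rintro rfl
      exact aeval_two_k_ne_zero n hk
    · rwa [← sub_neg_eq_add, sub_ne_zero]
  -- A root of k annihilates f on the diagonal, so any pair with these traces satisfies the
  -- relation.
  have hrel : A * (A * B⁻¹ * A⁻¹ * B) ^ n = (A * B⁻¹ * A⁻¹ * B) ^ n * B := by
    have h := mul_zpow_sub tA tB tAB n
    rw [hf, zero_smul, sub_eq_zero] at h
    exact Subtype.ext h
  have ht : HasTraces (knotHom A B hrel) α α := by
    refine ⟨by rw [knotHom_genA, tA], ?_⟩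
    rw [map_mul, knotHom_genA, knotHom_genB, coe_mul_eq, tAB]
  refine ⟨knotHom A B hrel, (isAbsIrreducible_iff_zVal_ne_two ht).mpr hz, fun h => ?_, ht⟩
  exact (isAcyclic_iff ht hf hz).mp h hτ

end TwistKnot

theorem mainTheorem6 (n : ℤ) :
    -- the factorizations on the diagonal
    (TwistKnot.diag (TwistKnot.f n) = TwistKnot.g n * TwistKnot.k n ∧
      TwistKnot.diag (TwistKnot.τ n) = 2 * TwistKnot.h n * TwistKnot.k n) ∧
    -- the explicit Chebyshev form of `k`
    (TwistKnot.k (2 * n) =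
        (TwistKnot.cheb (3 * n)).comp (1 - Polynomial.X) +
          (TwistKnot.cheb (3 * n - 1)).comp (1 - Polynomial.X) ∧
      TwistKnot.k (2 * n + 1) = (TwistKnot.cheb (3 * n + 1)).comp (1 - Polynomial.X)) ∧
    -- `k n` is a greatest common divisor of `f n (x, x)` and `τ n (x, x)` in `ℤ[x]`
    (TwistKnot.k n ∣ TwistKnot.diag (TwistKnot.f n) ∧
      TwistKnot.k n ∣ TwistKnot.diag (TwistKnot.τ n) ∧
      ∀ d : Polynomial ℤ, d ∣ TwistKnot.diag (TwistKnot.f n) →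
        d ∣ TwistKnot.diag (TwistKnot.τ n) → d ∣ TwistKnot.k n) ∧
    -- absolutely irreducible non-acyclic representations over a finite field of
    -- characteristic `p > 2`, up to conjugacy, correspond to the roots `α ≠ -1` of `k n`
    (∀ (F : Type) [Field F] [Finite F] (p : ℕ) [CharP F p], 2 < p →
      (∀ ρ : TwistKnot.KnotGroup n →* Matrix.SpecialLinearGroup (Fin 2) F,
        TwistKnot.IsAbsIrreducible ρ → ¬ TwistKnot.IsAcyclic ρ →
          ∃ α : F, Polynomial.aeval α (TwistKnot.k n) = 0 ∧ α ≠ -1 ∧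
            TwistKnot.HasTraces ρ α α) ∧
      (∀ α : F, Polynomial.aeval α (TwistKnot.k n) = 0 → α ≠ -1 →
        ∃ ρ : TwistKnot.KnotGroup n →* Matrix.SpecialLinearGroup (Fin 2) F,
          TwistKnot.IsAbsIrreducible ρ ∧ ¬ TwistKnot.IsAcyclic ρ ∧
            TwistKnot.HasTraces ρ α α) ∧
      (∀ (α : F) (ρ ρ' : TwistKnot.KnotGroup n →* Matrix.SpecialLinearGroup (Fin 2) F),
        TwistKnot.IsAbsIrreducible ρ → TwistKnot.IsAbsIrreducible ρ' →
          TwistKnot.HasTraces ρ α α → TwistKnot.HasTraces ρ' α α →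
            TwistKnot.IsConjugate ρ ρ')) := by
  refine ⟨⟨TwistKnot.diag_f_eq n, TwistKnot.diag_τ_eq n⟩, TwistKnot.k_eq_cheb n, ?_, ?_⟩
  · rw [TwistKnot.diag_f_eq, TwistKnot.diag_τ_eq]
    exact ⟨Dvd.intro_left _ rfl, Dvd.intro_left _ rfl, fun d => TwistKnot.dvd_k_of_dvd⟩
  · intro F _ _ p _ hp
    have h2 : (2 : F) ≠ 0 := by
      intro h
      have h' : ((2 : ℕ) : F) = 0 := by exact_mod_cast h
      exact absurd (Nat.le_of_dvd two_pos ((CharP.cast_eq_zero_iff F p 2).mp h'))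
        (not_le.mpr hp)
    exact ⟨fun ρ => TwistKnot.exists_root_of_not_isAcyclic h2,
      fun α => TwistKnot.exists_hom_of_root h2,
      fun α ρ ρ' => TwistKnot.isConjugate_of_hasTraces⟩
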